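/- Let $\mathcal H$ be a finite-dimensional Hilbert space. For density matrices $\rho,\sigma$ on $\mathcal H$ put $$D(\rho\|\sigma)=\mathrm{Tr}\,\rho(\log\rho-\log\sigma),\qquad \underline D(\rho\|\sigma)=\mathrm{Tr}\,\rho\log(\sigma^{-1/2}\rho\sigma^{-1/2}),$$ $$\psi(s|\rho\|\sigma)=\log\mathrm{Tr}\,\rho^{1+s}\sigma^{-s},\qquad \underline\psi^*(s|\rho\|\sigma)=\log\mathrm{Tr}\,\rho(\sigma^{-1/2}\rho\sigma^{-1/2})^s ,$$ where negative powers of $\sigma$ are taken on its support, $\log 0=-\infty$ and $0\cdot(-\infty)=0$ (so that $\underline D$ may be $-\infty$), and $D=+\infty$ unless $\mathrm{supp}\,\rho\subseteq\mathrm{supp}\,\sigma$. For a classical-quantum channel $W=(W_x)_{x\in\mathcal X}$ (a family of density matrices on $\mathcal H$ indexed by a finite set $\mathcal X$) and a distribution $p$ on $\mathcal X$, let $W_p=\sum_x p(x)W_x$, let $\rho[W,p]=\sum_x p(x)|x\rangle\langle x|\otimes W_x$ with marginals $\rho[W,p]_A$ and $\rho[W,p]_E$, and put $\psi(s|W,p)=\psi(s|\rho[W,p]\,\|\,\rho[W,p]_A\otimes\rho[W,p]_E)$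 and $\underline\psi^*(s|W,p)=\underline\psi^*(s|\rho[W,p]\,\|\,\rho[W,p]_A\otimes\rho[W,p]_E)$. For a distribution $P^A$ on a finite set $\mathcal A$ let $H_{1+s}(P^A)=-\frac1s\log\sum_a P^A(a)^{1+s}$. Now let $\mathcal A$ and $\mathcal X$ be finite modules over a ring, $W$ a classical-quantum channel on $\mathcal X$, $P_{\mathrm{mix}}$ the uniform distribution on $\mathcal X$, and $P^A$ a distribution on $\mathcal A$. Let $f_{\mathbf X}:\mathcal A\to\mathcal X$ be a random injective module homomorphism such that, for all $x\in\mathcal X\setminus\{0\}$ and $a\in\mathcal A\setminus\{0\}$, $$\Pr[f_{\mathbf X}(a)=x]\le\frac1{|\mathcal X|-1}.$$ Let $Y$ be uniformly distributed on $\mathcal X$ and independent of $f_{\mathbf X}$, and put $\Psi_{\mathbf X,Y}(a)=f_{\mathbf X}(a)+Y$. Write $P^A\circ\Psi_{\mathbf X,Y}^{-1}$ for the image distribution of $P^A$ under $\Psi_{\mathbf X,Y}$, and let $v$ be the number of distinct eigenvalues of $W_{P_{\mathrm{mix}}}$. Then, for every $s\in(0,1]$, $$\mathrm E_{\mathbf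 X,Y}\,D\bigl(W_{P^A\circ\Psi_{\mathbf X,Y}^{-1}}\big\|W_{P_{\mathrm{mix}}}\bigr)\le\frac{v^s\,e^{-sH_{1+s}(P^A)}\,e^{\psi(s|W,P_{\mathrm{mix}})}}{s}$$ and $$\mathrm E_{\mathbf X,Y}\,e^{s\underline D(W_{P^A\circ\Psi_{\mathbf X,Y}^{-1}}\|W_{P_{\mathrm{mix}}})}\le\mathrm E_{\mathbf X,Y}\,e^{\underline\psi^*(s|W_{P^A\circ\Psi_{\mathbf X,Y}^{-1}}\|W_{P_{\mathrm{mix}}})}\le 1+e^{-sH_{1+s}(P^A)}\,e^{\underline\psi^*(s|W,P_{\mathrm{mix}})} .$$ -/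

import Mathlib

open scoped Kronecker ComplexOrder

noncomputable section

namespace CQ

/-- Density matrices (states) on the finite-dimensional Hilbert space `ℂ^d`. -/
def IsDensity {d : Type*} [Fintype d] (ρ : Matrix d d ℂ) : Prop :=
  ρ.PosSemidef ∧ ρ.trace = 1

/-- `supp ρ ⊆ supp σ` for Hermitian matrices, i.e. `ker σ ⊆ ker ρ`. -/
def SuppLE {d : Type*} [Fintype d] (ρ σ : Matrix d d ℂ) : Prop :=
  ∀ v : d → ℂ, Matrix.mulVec σ v = 0 → Matrix.mulVec ρ v = 0

/-- The power `ρ ^ t` of a positive semidefinite matrix by functional calculus. For `t < 0` this is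
the inverse power on the support of `ρ` and zero on the kernel, since `(0 : ℝ) ^ t = 0`. -/
def mpow {d : Type*} [Fintype d] [DecidableEq d] (ρ : Matrix d d ℂ) (t : ℝ) : Matrix d d ℂ :=
  cfc (fun x : ℝ => x ^ t) ρ

/-- The logarithm of a positive semidefinite matrix on its support (and zero on its kernel). -/
def mlog {d : Type*} [Fintype d] [DecidableEq d] (ρ : Matrix d d ℂ) : Matrix d d ℂ :=
  cfc Real.log ρ

/-- The orthogonal projection onto the kernel of a Hermitian matrix. -/
def kerProj {d : Type*} [Fintype d] [DecidableEq d] (ρ : Matrix d d ℂ) : Matrix d d ℂ :=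
  cfc (fun x : ℝ => if x = 0 then (1 : ℝ) else 0) ρ

/-- `σ^{-1/2} ρ σ^{-1/2}`. -/
def sandwich {d : Type*} [Fintype d] [DecidableEq d] (ρ σ : Matrix d d ℂ) : Matrix d d ℂ :=
  mpow σ (-1 / 2) * ρ * mpow σ (-1 / 2)

open Classical in
/-- The relative entropy `D(ρ‖σ) = Tr ρ (log ρ - log σ)`, equal to `+∞` unless
`supp ρ ⊆ supp σ`. -/
def relEnt {d : Type*} [Fintype d] [DecidableEq d] (ρ σ : Matrix d d ℂ) : EReal :=
  if SuppLE ρ σ then (((ρ * (mlog ρ - mlog σ)).trace.re : ℝ) : EReal) else ⊤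

open Classical in
/-- The second relative entropy `Tr ρ log (σ^{-1/2} ρ σ^{-1/2})`, with `log 0 = -∞` and
`0 * (-∞) = 0`: it is `-∞` when `ρ` has positive weight on the kernel of `σ^{-1/2} ρ σ^{-1/2}`
(this can happen even if `supp ρ ⊆ supp σ`). -/
def relEntLow {d : Type*} [Fintype d] [DecidableEq d] (ρ σ : Matrix d d ℂ) : EReal :=
  if SuppLE ρ σ then
    if (ρ * kerProj (sandwich ρ σ)).trace = 0 then
      (((ρ * mlog (sandwich ρ σ)).trace.re : ℝ) : EReal)
    else ⊥
  else ⊤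

/-- `ψ(s|ρ‖σ) = log Tr ρ^{1+s} σ^{-s}` (for `supp ρ ⊆ supp σ`). -/
def psi {d : Type*} [Fintype d] [DecidableEq d] (s : ℝ) (ρ σ : Matrix d d ℂ) : ℝ :=
  Real.log (mpow ρ (1 + s) * mpow σ (-s)).trace.re

/-- `log Tr ρ (σ^{-1/2} ρ σ^{-1/2})^s` (for `supp ρ ⊆ supp σ`). -/
def psiLow {d : Type*} [Fintype d] [DecidableEq d] (s : ℝ) (ρ σ : Matrix d d ℂ) : ℝ :=
  Real.log (ρ * mpow (sandwich ρ σ) s).trace.re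

/-- The number of (distinct) eigenvalues of a matrix. -/
def numEigenvalues {d : Type*} [Fintype d] [DecidableEq d] (σ : Matrix d d ℂ) : ℕ :=
  (spectrum ℂ σ).ncard

/-- The output state `W_p = ∑ₓ p(x) Wₓ`. -/
def output {X d : Type*} [Fintype X] (W : X → Matrix d d ℂ) (p : X → ℝ) : Matrix d d ℂ :=
  ∑ x, p x • W x

/-- The classical-quantum state `ρ[W,p] = ∑ₓ p(x) |x⟩⟨x| ⊗ Wₓ`. -/
def cqState {X d : Type*} [Fintype X] [DecidableEq X] (W : X → Matrix d d ℂ) (p : X → ℝ) :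
    Matrix (X × d) (X × d) ℂ :=
  ∑ x, p x • (Matrix.single x x (1 : ℂ) ⊗ₖ W x)

/-- The marginal state on the first system. -/
def marginalA {X d : Type*} [Fintype d] (ρ : Matrix (X × d) (X × d) ℂ) : Matrix X X ℂ :=
  fun i j => ∑ k, ρ (i, k) (j, k)

/-- The marginal state on the second system. -/
def marginalE {X d : Type*} [Fintype X] (ρ : Matrix (X × d) (X × d) ℂ) : Matrix d d ℂ :=
  fun k l => ∑ i, ρ (i, k) (i, l)

/-- `ψ(s|W,p) = ψ(s|ρ[W,p]‖ρ[W,p]_A ⊗ ρ[W,p]_E)`. -/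
def psiChannel {X d : Type*} [Fintype X] [DecidableEq X] [Fintype d] [DecidableEq d]
    (s : ℝ) (W : X → Matrix d d ℂ) (p : X → ℝ) : ℝ :=
  psi s (cqState W p) (marginalA (cqState W p) ⊗ₖ marginalE (cqState W p))

/-- The analogue of `psiChannel` for `psiLow`. -/
def psiLowChannel {X d : Type*} [Fintype X] [DecidableEq X] [Fintype d] [DecidableEq d]
    (s : ℝ) (W : X → Matrix d d ℂ) (p : X → ℝ) : ℝ :=
  psiLow s (cqState W p) (marginalA (cqState W p) ⊗ₖ marginalE (cqState W p))

/-- The Rényi entropy `H_{1+s}(P) = -(1/s) log ∑ₐ P(a)^{1+s}`. -/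
def renyi {A : Type*} [Fintype A] (s : ℝ) (P : A → ℝ) : ℝ :=
  (-1 / s) * Real.log (∑ a, P a ^ (1 + s))

/-- The uniform distribution. -/
def unif (X : Type*) [Fintype X] : X → ℝ := fun _ => 1 / (Fintype.card X : ℝ)

/-- The image distribution `P ∘ g⁻¹`. -/
def pushforward {A X : Type*} [Fintype A] [DecidableEq X] (P : A → ℝ) (g : A → X) : X → ℝ :=
  fun x => ∑ a with g a = x, P a

end CQ

end

set_option linter.unusedSectionVars false

namespace CQ

open Matrix
open scoped Kronecker ComplexOrder Matrix.Norms.L2Operator MatrixOrder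

/-! ### Spectral calculus in a fixed eigenbasis, and Klein's inequality. -/

section Spectral

variable {d : Type*} [Fintype d] [DecidableEq d]

/-! Both averages have the form E Tr W_out Φ(W_out), where Φ is an operator concave function of the
output: a logarithm minus a constant, or the `s`-th power of the sandwiched matrix. Expand the first
factor as a sum over `a` and substitute `y = x - f(a)`: since the shift is uniform and independent
of `f`, `x` is again uniform and independent of `f`. Jensen's operator inequality over `f` then
replaces the argument of Φ by its conditional mean (`IsRandomEmbedding.sum_trace_le`).

Injectivity excludes the value 0 at a nonzero point, so the |X| - 1 probability bounds must all be
equalities. Hence the conditional mean is M = α W_x + (1 - α) W_mix with α = (|X| P(a) - 1)/(|X| -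
1) ≤ P(a) (`condMean`, `condCoeff_le`). It remains to bound Tr W_x Φ(M) for one state.

The coefficient α is negative when P(a) < 1/|X|; the crude bound M ≤ (1 - α) W_mix would then lose a
factor above 1. Instead, moving away from W_x is shown to give no gain: for the power by Bernoulli's
inequality and Tr ρσ^{-1/2}ρσ^{-1/2} ≥ 1 (`trace_mul_mpow_sandwich_le`), for the logarithm by
applying Klein's inequality in both directions (`trace_mul_mlog_sub_le_of_neg`). When α ≥ 0, the
power is handled by subadditivity of t^s, and the logarithm by pinching W_x to a matrix commuting
with W_mix, which costs the factor `v`, followed by log(1 + x) ≤ x^s / s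
(`trace_mul_mlog_sub_le_of_nonneg`).

Logarithms are regularised by ε·1 so that operator monotonicity and concavity apply to singular
matrices; the error is linear in ε. The comparison of the second relative entropy with its Rényi
version is pointwise, by scalar Jensen for exp. -/

lemma exists_polynomial_eq_on {S : Set ℝ} (hS : S.Finite) (f : ℝ → ℝ) :
    ∃ q : Polynomial ℝ, ∀ x ∈ S, q.eval x = f x := by
  classical
  refine ⟨Lagrange.interpolate hS.toFinset id f, fun x hx => ?_⟩
  have := Lagrange.eval_interpolate_at_node (s := hS.toFinset) (v := id) f
    (Function.injective_id.injOn) (hS.mem_toFinset.2 hx)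
  simpa using this

/-- `A` is diagonalised by the unitary `U`, with real eigenvalues `a`. -/
structure HasDiag (A U : Matrix d d ℂ) (a : d → ℝ) : Prop where
  unitary : U ∈ Matrix.unitaryGroup d ℂ
  eq : A = U * diagonal (fun i => (a i : ℂ)) * star U

/-- The weight of `ρ` in the direction of the `i`-th column of `U`. -/
def weight (ρ U : Matrix d d ℂ) (i : d) : ℝ := ((star U * ρ * U) i i).re

lemma exists_hasDiag {A : Matrix d d ℂ} (hA : A.IsHermitian) :
    ∃ U a, HasDiag A U a :=
  ⟨hA.eigenvectorUnitary, hA.eigenvalues, hA.eigenvectorUnitary.2, by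
    conv_lhs => rw [hA.spectral_theorem]
    rfl⟩

namespace HasDiag

variable {A U : Matrix d d ℂ} {a : d → ℝ}

lemma star_mul_self (h : HasDiag A U a) : star U * U = 1 :=
  Unitary.star_mul_self_of_mem h.unitary

lemma mul_star_self (h : HasDiag A U a) : U * star U = 1 :=
  Unitary.mul_star_self_of_mem h.unitary

lemma isHermitian (h : HasDiag A U a) : A.IsHermitian := by
  have : (diagonal (fun i => (a i : ℂ))).IsHermitian := by
    rw [isHermitian_diagonal_iff]; intro i; simp [isSelfAdjoint_iff]
  rw [h.eq]
  exact isHermitian_mul_mul_conjTranspose _ this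

lemma star_mul_mul (h : HasDiag A U a) :
    star U * A * U = diagonal (fun i => (a i : ℂ)) := by
  rw [h.eq]
  calc _ = (star U * U) * diagonal (fun i => (a i : ℂ)) * (star U * U) := by
        simp only [mul_assoc]
    _ = _ := by rw [h.star_mul_self]; simp

lemma weight_self (h : HasDiag A U a) (i : d) : weight A U i = a i := by
  simp [weight, h.star_mul_mul]

/-- On a finite set `f` agrees with a polynomial, and polynomials commute with the algebra
homomorphism sending `b` to U diag(b) U*. No continuity of `f` is needed, which covers negative
powers and `Real.log` at 0. -/
lemma cfc (h : HasDiag A U a) (f : ℝ → ℝ) : HasDiag (cfc f A) U (fun i => f (a i)) := by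
  refine ⟨h.unitary, ?_⟩
  obtain ⟨q, hq⟩ := exists_polynomial_eq_on
    (A.finite_real_spectrum.union (Set.finite_range a)) f
  have hA : IsSelfAdjoint A := h.isHermitian
  have h1 : _root_.cfc f A = Polynomial.aeval A q := by
    rw [← cfc_polynomial q A hA]
    exact cfc_congr fun x hx => (hq x (Or.inl hx)).symm
  let φ : (d → ℝ) →ₐ[ℝ] Matrix d d ℂ :=
    (Unitary.conjStarAlgAut ℝ (Matrix d d ℂ) ⟨U, h.unitary⟩ : _ →⋆ₐ[ℝ] _).toAlgHom.comp
      ((diagonalAlgHom (n := d) (α := ℂ) ℝ).comp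
        (AlgHom.compLeft (Complex.ofRealAm) d))
  have hφ : ∀ b : d → ℝ, φ b = U * diagonal (fun i => (b i : ℂ)) * star U := fun b => rfl
  rw [h1, h.eq, ← hφ, ← hφ, Polynomial.aeval_algHom_apply]
  congr 1
  ext i
  have := (Polynomial.aeval_algHom_apply (Pi.evalAlgHom ℝ (fun _ : d => ℝ) i) a q).symm
  simp only [Pi.evalAlgHom_apply] at this
  rw [this, Polynomial.coe_aeval_eq_eval]
  exact hq _ (Or.inr ⟨i, rfl⟩)

lemma trace_mul (h : HasDiag A U a) (ρ : Matrix d d ℂ) :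
    (ρ * A).trace.re = ∑ i, weight ρ U i * a i := by
  have : (ρ * A).trace = ((star U * ρ * U) * diagonal (fun i => (a i : ℂ))).trace := by
    conv_lhs => rw [h.eq]
    rw [← mul_assoc, trace_mul_comm]
    simp only [mul_assoc]
  rw [this, trace, Complex.re_sum]
  refine Finset.sum_congr rfl fun i _ => ?_
  simp [weight, mul_diagonal]

lemma trace_mul_cfc (h : HasDiag A U a) (ρ : Matrix d d ℂ) (f : ℝ → ℝ) :
    (ρ * _root_.cfc f A).trace.re = ∑ i, weight ρ U i * f (a i) :=
  (h.cfc f).trace_mul ρ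

lemma nonneg (h : HasDiag A U a) (hA : A.PosSemidef) (i : d) : 0 ≤ a i := by
  have h1 := (hA.conjTranspose_mul_mul_same U).diag_nonneg (i := i)
  have h2 : Uᴴ * A * U = _ := h.star_mul_mul
  rw [h2] at h1
  simpa using h1

lemma mulVec_col (h : HasDiag A U a) (i : d) : A *ᵥ (U.col i) = (a i : ℂ) • U.col i := by
  have : A * U = U * diagonal (fun i => (a i : ℂ)) := by
    conv_lhs => rw [h.eq]
    rw [mul_assoc, h.star_mul_self, mul_one]
  ext k
  have := congrFun (congrFun this k) i
  rw [mul_diagonal] at this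
  simp only [mulVec, dotProduct, col_apply, Pi.smul_apply, smul_eq_mul]
  rw [mul_comm, ← this, Matrix.mul_apply]

lemma posSemidef_of_nonneg (h : HasDiag A U a) (ha : ∀ i, 0 ≤ a i) : A.PosSemidef := by
  rw [h.eq]
  refine PosSemidef.mul_mul_conjTranspose_same ?_ U
  exact PosSemidef.diagonal fun i => Complex.zero_le_real.2 (ha i)

end HasDiag

lemma weight_nonneg {ρ : Matrix d d ℂ} (hρ : ρ.PosSemidef) (U : Matrix d d ℂ) (i : d) :
    0 ≤ weight ρ U i := by
  have h1 := (hρ.conjTranspose_mul_mul_same U).diag_nonneg (i := i)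
  exact (Complex.le_def.1 h1).1

lemma sum_weight {U : Matrix d d ℂ} (hU : U ∈ Matrix.unitaryGroup d ℂ) (ρ : Matrix d d ℂ) :
    ∑ i, weight ρ U i = ρ.trace.re := by
  have : ρ.trace = (star U * ρ * U).trace := by
    rw [trace_mul_comm, ← mul_assoc, Unitary.mul_star_self_of_mem hU, one_mul]
  rw [this, trace, Complex.re_sum]
  rfl

lemma weight_eq_dotProduct (ρ U : Matrix d d ℂ) (i : d) :
    weight ρ U i = (star (U.col i) ⬝ᵥ (ρ *ᵥ U.col i)).re := by
  rw [weight, mul_assoc, Matrix.mul_apply]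
  rfl

/-- If `σ` kills the `i`-th eigenvector, so does every `ρ` supported in `σ`. -/
lemma weight_eq_zero {ρ σ U : Matrix d d ℂ} {a : d → ℝ} (h : HasDiag σ U a)
    (hs : SuppLE ρ σ) {i : d} (hi : a i = 0) : weight ρ U i = 0 := by
  rw [weight_eq_dotProduct, hs]
  · simp
  · rw [h.mulVec_col, hi]; simp

lemma trace_mul_re_nonneg {A B : Matrix d d ℂ} (hA : A.PosSemidef) (hB : B.PosSemidef) :
    0 ≤ (A * B).trace.re := by
  obtain ⟨U, b, h⟩ := exists_hasDiag hB.1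
  rw [h.trace_mul]
  exact Finset.sum_nonneg fun i _ => mul_nonneg (weight_nonneg hA _ _) (h.nonneg hB i)

lemma trace_mul_mono {ρ A B : Matrix d d ℂ} (hρ : ρ.PosSemidef) (h : A ≤ B) :
    (ρ * A).trace.re ≤ (ρ * B).trace.re := by
  have := trace_mul_re_nonneg hρ (Matrix.le_iff.1 h)
  rw [mul_sub, trace_sub, Complex.sub_re] at this
  linarith

/-- The doubly stochastic overlaps of two orthonormal bases. -/
def overlap (U V : Matrix d d ℂ) (i j : d) : ℝ := Complex.normSq ((star U * V) i j)

lemma overlap_nonneg (U V : Matrix d d ℂ) (i j : d) : 0 ≤ overlap U V i j :=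
  Complex.normSq_nonneg _

lemma weight_eq_sum_overlap {A U V : Matrix d d ℂ} {a : d → ℝ} (h : HasDiag A U a) (j : d) :
    weight A V j = ∑ i, a i * overlap U V i j := by
  have : star V * A * V = star (star U * V) * (diagonal (fun i => (a i : ℂ)) * (star U * V)) := by
    rw [h.eq, star_mul, star_star]; simp only [mul_assoc]
  rw [weight, this, Matrix.mul_apply, Complex.re_sum]
  refine Finset.sum_congr rfl fun i _ => ?_
  rw [diagonal_mul, overlap, star_eq_conjTranspose, conjTranspose_apply]
  simp [Complex.normSq_apply]
  ring

lemma hasDiag_one {U : Matrix d d ℂ} (hU : U ∈ Matrix.unitaryGroup d ℂ) :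
    HasDiag 1 U (fun _ => 1) :=
  ⟨hU, by simp [Unitary.mul_star_self_of_mem hU]⟩

lemma sum_overlap_left {U V : Matrix d d ℂ} (hU : U ∈ Matrix.unitaryGroup d ℂ)
    (hV : V ∈ Matrix.unitaryGroup d ℂ) (j : d) : ∑ i, overlap U V i j = 1 := by
  have h1 := weight_eq_sum_overlap (V := V) (hasDiag_one hU) j
  have h2 := (hasDiag_one hV).weight_self j
  simpa [h2] using h1.symm

lemma overlap_comm (U V : Matrix d d ℂ) (i j : d) : overlap U V i j = overlap V U j i := by
  have : star U * V = star (star V * U) := by simp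
  rw [overlap, this, star_eq_conjTranspose, conjTranspose_apply, overlap]
  simp

lemma sum_overlap_right {U V : Matrix d d ℂ} (hU : U ∈ Matrix.unitaryGroup d ℂ)
    (hV : V ∈ Matrix.unitaryGroup d ℂ) (i : d) : ∑ j, overlap U V i j = 1 := by
  simp_rw [overlap_comm U V i]
  exact sum_overlap_left hV hU i

/-- Klein's inequality for positive semidefinite matrices with nested supports. -/
lemma klein {A B : Matrix d d ℂ} (hA : A.PosSemidef) (hB : B.PosSemidef) (hs : SuppLE A B) :
    (A - B).trace.re ≤ (A * (mlog A - mlog B)).trace.re := by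
  obtain ⟨U, a, hU⟩ := exists_hasDiag hA.1
  obtain ⟨V, b, hV⟩ := exists_hasDiag hB.1
  -- Rows and columns of the overlap matrix sum to one, so all four traces become double sums with
  -- the same weights and only a scalar inequality remains.
  have e1 : (A * mlog A).trace.re = ∑ i, ∑ j, overlap U V i j * (a i * Real.log (a i)) := by
    rw [mlog, hU.trace_mul_cfc]
    refine Finset.sum_congr rfl fun i _ => ?_
    rw [← Finset.sum_mul, sum_overlap_right hU.unitary hV.unitary, one_mul, hU.weight_self]
  have e2 : (A * mlog B).trace.re = ∑ i, ∑ j, overlap U V i j * (a i * Real.log (b j)) := by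
    rw [mlog, hV.trace_mul_cfc, Finset.sum_comm]
    refine Finset.sum_congr rfl fun j _ => ?_
    rw [weight_eq_sum_overlap hU, Finset.sum_mul]
    exact Finset.sum_congr rfl fun i _ => by ring
  have e3 : A.trace.re = ∑ i, ∑ j, overlap U V i j * a i := by
    rw [← sum_weight hU.unitary A]
    refine Finset.sum_congr rfl fun i _ => ?_
    rw [← Finset.sum_mul, sum_overlap_right hU.unitary hV.unitary, one_mul, hU.weight_self]
  have e4 : B.trace.re = ∑ i, ∑ j, overlap U V i j * b j := by
    rw [← sum_weight hV.unitary B, Finset.sum_comm]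
    refine Finset.sum_congr rfl fun i _ => ?_
    rw [← Finset.sum_mul, sum_overlap_left hU.unitary hV.unitary, one_mul, hV.weight_self]
  rw [mul_sub, trace_sub, trace_sub, Complex.sub_re, Complex.sub_re, e1, e2, e3, e4]
  simp only [← Finset.sum_sub_distrib]
  refine Finset.sum_le_sum fun i _ => Finset.sum_le_sum fun j _ => ?_
  have ha := hU.nonneg hA i
  have hb := hV.nonneg hB j
  have ho := overlap_nonneg U V i j
  rcases ha.eq_or_lt with ha0 | ha0
  · rw [← ha0]; simp; positivity
  rcases hb.eq_or_lt with hb0 | hb0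
  -- Here `Real.log 0 = 0` would be the wrong value; the support condition makes the term vanish.
  · have hz : overlap U V i j = 0 := by
      have h1 := weight_eq_zero hV hs hb0.symm
      rw [weight_eq_sum_overlap hU,
        Finset.sum_eq_zero_iff_of_nonneg fun k _ =>
          mul_nonneg (hU.nonneg hA k) (overlap_nonneg U V k j)] at h1
      exact (mul_eq_zero.1 (h1 i (Finset.mem_univ _))).resolve_left ha0.ne'
    simp [hz]
  · have h1 := Real.log_le_sub_one_of_pos (div_pos hb0 ha0)
    rw [Real.log_div hb0.ne' ha0.ne'] at h1
    have h2 : a i * (Real.log (b j) - Real.log (a i)) ≤ b j - a i := by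
      calc _ ≤ a i * (b j / a i - 1) := by gcongr
        _ = _ := by field_simp
    nlinarith

lemma suppLE_of_posDef {A B : Matrix d d ℂ} (hB : B.PosDef) : SuppLE A B := by
  intro v hv
  by_cases h : v = 0
  · simp [h]
  · have := hB.dotProduct_mulVec_pos h
    rw [hv] at this
    simp at this

lemma posDef_add_smul_one {A : Matrix d d ℂ} (hA : A.PosSemidef) {ε : ℝ} (hε : 0 < ε) :
    (A + ε • (1 : Matrix d d ℂ)).PosDef :=
  PosDef.posSemidef_add hA (PosDef.one.smul hε)

lemma mlog_mono {A B : Matrix d d ℂ} (hA : A.PosDef) (h : A ≤ B) : mlog A ≤ mlog B :=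
  CFC.log_le_log h hA.isStrictlyPositive

lemma HasDiag.add_smul_one {A U : Matrix d d ℂ} {a : d → ℝ} (h : HasDiag A U a) (ε : ℝ) :
    HasDiag (A + ε • (1 : Matrix d d ℂ)) U (fun i => a i + ε) := by
  refine ⟨h.unitary, ?_⟩
  have : diagonal (fun i => ((a i + ε : ℝ) : ℂ))
      = diagonal (fun i => (a i : ℂ)) + ε • (1 : Matrix d d ℂ) := by
    rw [← diagonal_one, ← diagonal_smul, diagonal_add]
    congr 1; ext i; simp
  rw [this, mul_add, add_mul, ← h.eq]
  simp [h.mul_star_self]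

end Spectral

/-! ### Powers of the sandwiched matrix. -/

section Power

variable {d : Type*} [Fintype d] [DecidableEq d]

namespace HasDiag

variable {A B U : Matrix d d ℂ} {a b : d → ℝ}

lemma mul (hA : HasDiag A U a) (hB : HasDiag B U b) :
    HasDiag (A * B) U (fun i => a i * b i) := by
  refine ⟨hA.unitary, ?_⟩
  have : diagonal (fun i => ((a i * b i : ℝ) : ℂ))
      = diagonal (fun i => (a i : ℂ)) * diagonal (fun i => (b i : ℂ)) := by
    rw [diagonal_mul_diagonal]; simp
  rw [this]
  conv_lhs => rw [hA.eq, hB.eq]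
  calc _ = U * diagonal (fun i => (a i : ℂ)) * (star U * U) * diagonal (fun i => (b i : ℂ))
          * star U := by simp only [mul_assoc]
    _ = _ := by rw [hA.star_mul_self]; simp only [mul_assoc, one_mul]

lemma add (hA : HasDiag A U a) (hB : HasDiag B U b) :
    HasDiag (A + B) U (fun i => a i + b i) := by
  refine ⟨hA.unitary, ?_⟩
  have : diagonal (fun i => ((a i + b i : ℝ) : ℂ))
      = diagonal (fun i => (a i : ℂ)) + diagonal (fun i => (b i : ℂ)) := by
    rw [diagonal_add]; simp
  rw [this, mul_add, add_mul, ← hA.eq, ← hB.eq]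

lemma smul (hA : HasDiag A U a) (c : ℝ) : HasDiag (c • A) U (fun i => c * a i) := by
  refine ⟨hA.unitary, ?_⟩
  have : diagonal (fun i => ((c * a i : ℝ) : ℂ)) = c • diagonal (fun i => (a i : ℂ)) := by
    rw [← diagonal_smul]; congr 1; ext i; simp
  rw [this, mul_smul_comm, smul_mul_assoc, ← hA.eq]

lemma congr (hA : HasDiag A U a) (h : ∀ i, a i = b i) : HasDiag A U b := by
  rwa [← funext h]

lemma ext (hA : HasDiag A U a) (hB : HasDiag B U a) : A = B := hA.eq.trans hB.eq.symm

end HasDiag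

lemma le_of_hasDiag {A B U : Matrix d d ℂ} {a b : d → ℝ} (hA : HasDiag A U a)
    (hB : HasDiag B U b) (h : ∀ i, a i ≤ b i) : A ≤ B := by
  rw [Matrix.le_iff]
  refine HasDiag.posSemidef_of_nonneg (U := U) (a := fun i => b i + (-1) * a i) ?_ ?_
  · rw [sub_eq_add_neg, ← neg_one_smul ℝ]
    exact hB.add (hA.smul (-1))
  · intro i; linarith [h i]

lemma posSemidef_mpow {A : Matrix d d ℂ} (hA : A.PosSemidef) (t : ℝ) : (mpow A t).PosSemidef := by
  obtain ⟨U, a, h⟩ := exists_hasDiag hA.1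
  exact (h.cfc (· ^ t)).posSemidef_of_nonneg fun i => Real.rpow_nonneg (h.nonneg hA i) t

lemma posSemidef_sandwich {A B : Matrix d d ℂ} (hA : A.PosSemidef) (hB : B.PosSemidef) :
    (sandwich A B).PosSemidef := by
  have := hA.mul_mul_conjTranspose_same (mpow B (-1 / 2))
  rwa [(posSemidef_mpow hB _).1.eq] at this

/-- `sandwich` as a linear map in its first argument. -/
noncomputable def sandwichLM (σ : Matrix d d ℂ) : Matrix d d ℂ →ₗ[ℝ] Matrix d d ℂ where
  toFun A := sandwich A σ
  map_add' A B := by simp [sandwich, mul_add, add_mul]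
  map_smul' c A := by simp [sandwich]

lemma sandwichLM_apply (A σ : Matrix d d ℂ) : sandwichLM σ A = sandwich A σ := rfl

lemma mpow_mono {A B : Matrix d d ℂ} (hA : A.PosSemidef) (h : A ≤ B) {s : ℝ} (hs0 : 0 ≤ s)
    (hs1 : s ≤ 1) : mpow A s ≤ mpow B s := by
  have hB : 0 ≤ B := hA.nonneg.trans h
  have := CFC.rpow_le_rpow ⟨hs0, hs1⟩ h
  rwa [CFC.rpow_eq_cfc_real hA.nonneg, CFC.rpow_eq_cfc_real hB] at this

lemma concaveOn_mpow {s : ℝ} (hs0 : 0 ≤ s) (hs1 : s ≤ 1) :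
    ConcaveOn ℝ {A : Matrix d d ℂ | A.PosSemidef} (fun A => mpow A s) := by
  have h := CFC.concaveOn_rpow (A := Matrix d d ℂ) ⟨hs0, hs1⟩
  have e : {A : Matrix d d ℂ | A.PosSemidef} = Set.Ici 0 := by
    ext A; exact (Matrix.nonneg_iff_posSemidef).symm
  rw [e]
  refine h.congr fun A hA => ?_
  exact CFC.rpow_eq_cfc_real hA

/-- The sandwiched square `Tr ρ σ^{-1/2} ρ σ^{-1/2}` of states is at least one. -/
lemma one_le_trace_mul_sandwich {ρ σ : Matrix d d ℂ} (hρ : IsDensity ρ) (hσ : IsDensity σ)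
    (hs : SuppLE ρ σ) : 1 ≤ (ρ * sandwich ρ σ).trace.re := by
  obtain ⟨U, a, hU⟩ := exists_hasDiag hσ.1.1
  have ha := hU.nonneg hσ.1
  set t := mpow σ (-1 / 4) with ht
  set S := mpow σ (1 / 2) with hS
  have htd : HasDiag t U (fun i => a i ^ (-1 / 4 : ℝ)) := hU.cfc _
  have hSd : HasDiag S U (fun i => a i ^ (1 / 2 : ℝ)) := hU.cfc _
  have htt : t * t = mpow σ (-1 / 2) := by
    refine ((htd.mul htd).congr fun i => ?_).ext (hU.cfc (· ^ (-1 / 2 : ℝ)))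
    rcases (ha i).eq_or_lt with h | h
    · rw [← h, Real.zero_rpow (by norm_num), Real.zero_rpow (by norm_num), zero_mul]
    · rw [← Real.rpow_add h]; norm_num
  have hSS : S * S = σ := by
    refine ((hSd.mul hSd).congr fun i => ?_).ext hU
    rw [← Real.rpow_add' (ha i) (by norm_num)]; norm_num
  set K := t * ρ * t with hK
  have hKH : K.IsHermitian := by
    have := hρ.1.mul_mul_conjTranspose_same t
    rw [htd.isHermitian.eq] at this
    exact this.1
  -- With K = σ^{-1/4}ρσ^{-1/4} and S = σ^{1/2}, both Tr KS and Tr S² equal 1, so expanding the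
  -- square gives Tr K² ≥ 1.
  have h1 : 0 ≤ ((K - S) * (K - S)).trace.re := by
    have h2 := (posSemidef_self_mul_conjTranspose (K - S)).trace_nonneg
    rw [(hKH.sub hSd.isHermitian).eq] at h2
    exact (Complex.le_def.1 h2).1
  have hKK : (K * K).trace = (ρ * sandwich ρ σ).trace := by
    rw [sandwich, ← htt, hK, show t * ρ * t * (t * ρ * t) = t * (ρ * t * t * ρ * t) by
      simp only [mul_assoc], trace_mul_comm]
    simp only [mul_assoc]
  have hKS : (K * S).trace.re = 1 := by
    have e : (K * S).trace = (ρ * (t * S * t)).trace := by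
      rw [hK, show t * ρ * t * S = t * (ρ * t * S) by simp only [mul_assoc], trace_mul_comm]
      simp only [mul_assoc]
    rw [e, ((htd.mul hSd).mul htd).trace_mul]
    have : ∀ i, weight ρ U i * (a i ^ (-1 / 4 : ℝ) * a i ^ (1 / 2 : ℝ) * a i ^ (-1 / 4 : ℝ))
        = weight ρ U i := by
      intro i
      rcases (ha i).eq_or_lt with h | h
      · rw [weight_eq_zero hU hs h.symm, zero_mul]
      · rw [← Real.rpow_add h, ← Real.rpow_add h]; norm_num
    rw [Finset.sum_congr rfl fun i _ => this i, sum_weight hU.unitary, hρ.2]; simp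
  rw [sub_mul, mul_sub, mul_sub, hSS, trace_sub, trace_sub, trace_sub, trace_mul_comm S K, hKK,
    hσ.2] at h1
  simp only [Complex.sub_re, hKS, Complex.one_re] at h1
  linarith

/-- The left side is the support projection of `σ`. -/
lemma sandwich_self_le_one {σ : Matrix d d ℂ} (hσ : σ.PosSemidef) : sandwich σ σ ≤ 1 := by
  obtain ⟨U, a, hU⟩ := exists_hasDiag hσ.1
  have h := hU.cfc (· ^ (-1 / 2 : ℝ))
  refine le_of_hasDiag ((h.mul hU).mul h) (hasDiag_one hU.unitary) fun i => ?_
  have ha := hU.nonneg hσ i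
  rcases ha.eq_or_lt with h | h
  · rw [← h]; simp
  · have : a i ^ (-1 / 2 : ℝ) * a i * a i ^ (-1 / 2 : ℝ) = 1 := by
      nth_rw 2 [← Real.rpow_one (a i)]
      rw [← Real.rpow_add h, ← Real.rpow_add h]; norm_num
    exact this.le

/-- Comparison of the sandwiched power of an affine combination of `ρ` and `σ` with that
of `ρ`; the coefficient `α` may be negative. -/
lemma trace_mul_mpow_sandwich_le {ρ σ : Matrix d d ℂ} (hρ : IsDensity ρ) (hσ : IsDensity σ)
    (hs : SuppLE ρ σ) {α p s : ℝ} (hs0 : 0 < s) (hs1 : s ≤ 1) (hp0 : 0 ≤ p) (hp1 : p ≤ 1)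
    (hα : α ≤ p) (hM : (α • ρ + (1 - α) • σ).PosSemidef) :
    (ρ * mpow (sandwich (α • ρ + (1 - α) • σ) σ) s).trace.re ≤
      1 + p ^ s * (ρ * mpow (sandwich ρ σ) s).trace.re := by
  have hρ' := posSemidef_sandwich hρ.1 hσ.1
  have hM' := posSemidef_sandwich hM hσ.1
  obtain ⟨V, t, hV⟩ := exists_hasDiag hρ'.1
  have ht := hV.nonneg hρ'
  -- The upper bound commutes with `sandwich ρ σ`, so after operator monotonicity everything is
  -- scalar in one eigenbasis. Only 1 - α ≥ 0 is needed here, not the sign of α.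
  have hle : sandwich (α • ρ + (1 - α) • σ) σ ≤ α • sandwich ρ σ + (1 - α) • 1 := by
    rw [← sandwichLM_apply, map_add, map_smul, map_smul, sandwichLM_apply, sandwichLM_apply]
    have h1 : (0 : ℝ) ≤ 1 - α := by linarith
    have := (Matrix.le_iff.1 (sandwich_self_le_one hσ.1)).smul h1
    rw [Matrix.le_iff]
    convert this using 1
    rw [smul_sub]; abel
  have hB := (hV.smul α).add_smul_one (1 - α)
  have hBnn : ∀ i, 0 ≤ α * t i + (1 - α) :=
    hB.nonneg (Matrix.nonneg_iff_posSemidef.1 (hM'.nonneg.trans hle))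
  have hw := weight_nonneg hρ.1 V
  have hw1 : ∑ i, weight ρ V i = 1 := by rw [sum_weight hV.unitary, hρ.2]; simp
  have hT : (ρ * mpow (sandwich ρ σ) s).trace.re = ∑ i, weight ρ V i * t i ^ s :=
    hV.trace_mul_cfc ρ _
  refine (trace_mul_mono hρ.1 (mpow_mono hM' hle hs0.le hs1)).trans ?_
  rw [mpow, hB.trace_mul_cfc, hT]
  rcases le_or_gt 0 α with h0 | h0
  · calc _ ≤ ∑ i, weight ρ V i * (1 + p ^ s * t i ^ s) := by
          gcongr with i _
          · exact hw i
          calc _ ≤ (α * t i) ^ s + (1 - α) ^ s :=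
                Real.rpow_add_le_add_rpow (mul_nonneg h0 (ht i)) (by linarith) hs0.le hs1
            _ ≤ (p * t i) ^ s + 1 := by
                have := ht i
                gcongr
                exact Real.rpow_le_one (by linarith) (by linarith) hs0.le
            _ = _ := by rw [Real.mul_rpow hp0 (ht i), add_comm]
      _ = _ := by
          simp_rw [mul_add, mul_one, Finset.sum_add_distrib, hw1, Finset.mul_sum]
          congr 1
          exact Finset.sum_congr rfl fun i _ => by ring
  · have h1 : 1 ≤ ∑ i, weight ρ V i * t i := by
      rw [← hV.trace_mul]; exact one_le_trace_mul_sandwich hρ hσ hs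
    have h2 : 0 ≤ p ^ s * ∑ i, weight ρ V i * t i ^ s :=
      mul_nonneg (Real.rpow_nonneg hp0 _)
        (Finset.sum_nonneg fun i _ => mul_nonneg (hw i) (Real.rpow_nonneg (ht i) _))
    -- Bernoulli linearises the power; the linear term sα(Σ w t - 1) is nonpositive because the
    -- weighted mean of `t` is at least 1.
    calc _ ≤ ∑ i, weight ρ V i * (1 + s * (α * t i - α)) := by
          gcongr with i _
          · exact hw i
          have := rpow_one_add_le_one_add_mul_self (s := α * t i - α)
            (by linarith [hBnn i]) hs0.le hs1
          rwa [show α * t i + (1 - α) = 1 + (α * t i - α) by ring]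
      _ = 1 + s * α * (∑ i, weight ρ V i * t i - 1) := by
          have e : ∀ i, weight ρ V i * (1 + s * (α * t i - α))
              = (1 - s * α) * weight ρ V i + s * α * (weight ρ V i * t i) := fun i => by ring
          simp_rw [e, Finset.sum_add_distrib, ← Finset.mul_sum, hw1]
          ring
      _ ≤ _ := by
          have : s * α * (∑ i, weight ρ V i * t i - 1) ≤ 0 :=
            mul_nonpos_of_nonpos_of_nonneg (mul_nonpos_of_nonneg_of_nonpos hs0.le h0.le)
              (by linarith)
          linarith

end Power

/-! ### Regularised logarithms. -/

section Log

variable {d : Type*} [Fintype d] [DecidableEq d]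

/-- Adding ε·1 moves the whole positive semidefinite cone into the strictly positive matrices, where
the logarithm is operator concave. -/
lemma concaveOn_mlog_add {ε : ℝ} (hε : 0 < ε) :
    ConcaveOn ℝ {A : Matrix d d ℂ | A.PosSemidef}
      (fun A => mlog (A + ε • (1 : Matrix d d ℂ))) := by
  have h := CFC.concaveOn_log (A := Matrix d d ℂ)
  refine ⟨fun A hA B hB s t hs ht _ => (hA.smul hs).add (hB.smul ht),
    fun A hA B hB s t hs ht hst => ?_⟩
  have := h.2 (posDef_add_smul_one hA hε).isStrictlyPositive
    (posDef_add_smul_one hB hε).isStrictlyPositive hs ht hst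
  have e : s • (A + ε • (1 : Matrix d d ℂ)) + t • (B + ε • (1 : Matrix d d ℂ))
      = s • A + t • B + ε • (1 : Matrix d d ℂ) := by
    obtain rfl : t = 1 - s := by linarith
    module
  rw [e] at this
  exact this

/-- An extrapolation `M` of `σ` away from `ρ` has a smaller logarithm in the state `ρ`. -/
lemma trace_mul_mlog_sub_le_of_neg {ρ σ : Matrix d d ℂ} (hρ : IsDensity ρ) (hσ : IsDensity σ)
    {α ε : ℝ} (hε : 0 < ε) (hα : α < 0) (hM : (α • ρ + (1 - α) • σ).PosSemidef) :
    (ρ * (mlog (α • ρ + (1 - α) • σ + ε • (1 : Matrix d d ℂ))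
      - mlog (σ + ε • (1 : Matrix d d ℂ)))).trace.re ≤ -α * ε * Fintype.card d := by
  set σ' := σ + ε • (1 : Matrix d d ℂ) with hσ'
  -- The regulariser is (1 - α)ε rather than ε so that `M'` is exactly αρ + (1 - α)σ'. Since 1 - α >
  -- 1, this only increases the logarithm.
  set M' := α • ρ + (1 - α) • σ + ((1 - α) * ε) • (1 : Matrix d d ℂ) with hM'
  have h1α : 0 < 1 - α := by linarith
  have hMM : M' = α • ρ + (1 - α) • σ' := by rw [hM', hσ']; module
  have pσ : σ'.PosDef := posDef_add_smul_one hσ.1 hε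
  have pM : M'.PosDef := posDef_add_smul_one hM (by positivity)
  have k1 := klein pσ.posSemidef pM.posSemidef (suppLE_of_posDef pM)
  have k2 := klein pM.posSemidef pσ.posSemidef (suppLE_of_posDef pσ)
  set L := mlog M' - mlog σ' with hL
  have hmono : (ρ * (mlog (α • ρ + (1 - α) • σ + ε • (1 : Matrix d d ℂ)) - mlog σ')).trace.re
      ≤ (ρ * L).trace.re := by
    refine trace_mul_mono hρ.1 (sub_le_sub_right (mlog_mono (posDef_add_smul_one hM hε) ?_) _)
    rw [Matrix.le_iff, hM']
    have : (((1 - α) * ε) - ε) • (1 : Matrix d d ℂ) = 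
      α • ρ + (1 - α) • σ + ((1 - α) * ε) • (1 : Matrix d d ℂ)
       - (α • ρ + (1 - α) • σ + ε • (1 : Matrix d d ℂ)) := by module
    rw [← this]
    exact PosSemidef.one.smul (by nlinarith)
  refine hmono.trans ?_
  have e1 : (M' * L).trace.re = α * (ρ * L).trace.re + (1 - α) * (σ' * L).trace.re := by
    rw [hMM, add_mul, trace_add, smul_mul_assoc, smul_mul_assoc, trace_smul, trace_smul]
    simp
  have e2 : (σ' * (mlog σ' - mlog M')).trace.re = - (σ' * L).trace.re := by
    rw [hL, ← neg_sub, mul_neg, trace_neg, Complex.neg_re]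
  have t1 : σ'.trace.re = 1 + ε * Fintype.card d := by
    rw [hσ', trace_add, hσ.2, trace_smul, trace_one]; simp
  have t2 : M'.trace.re = 1 + (1 - α) * ε * Fintype.card d := by
    rw [hM', trace_add, trace_add, trace_smul, trace_smul, trace_smul, hρ.2, hσ.2, trace_one]
    simp
  rw [trace_sub, Complex.sub_re, t1, t2] at k1 k2
  rw [e2] at k1
  rw [e1] at k2
  -- `k1` bounds Tr σ'L above by Tr(M' - σ') = -αεd. Inserted into `k2`, this isolates Tr ρL with
  -- the positive coefficient -α.
  have k3 : (-α) * (ρ * L).trace.re ≤ (-α) * (-α * ε * Fintype.card d) := by nlinarith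
  exact le_of_mul_le_mul_left k3 (by linarith)

/-- Regularisation of the relative entropy. -/
lemma trace_mlog_sub_le_regularised {ρ σ : Matrix d d ℂ} (hρ : ρ.PosSemidef)
    (hσ : σ.PosSemidef) (hs : SuppLE ρ σ) {ε : ℝ} (hε : 0 < ε) :
    (ρ * (mlog ρ - mlog σ)).trace.re ≤
      (ρ * (mlog (ρ + ε • (1 : Matrix d d ℂ)) - mlog (σ + ε • (1 : Matrix d d ℂ)))).trace.re
        + ε * (ρ * mpow σ (-1)).trace.re := by
  obtain ⟨U, a, hU⟩ := exists_hasDiag hρ.1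
  obtain ⟨V, b, hV⟩ := exists_hasDiag hσ.1
  have h1 : (ρ * mlog ρ).trace.re ≤ (ρ * mlog (ρ + ε • (1 : Matrix d d ℂ))).trace.re := by
    rw [mlog, mlog, hU.trace_mul_cfc, (hU.add_smul_one ε).trace_mul_cfc]
    refine Finset.sum_le_sum fun i _ => ?_
    rw [hU.weight_self]
    rcases (hU.nonneg hρ i).eq_or_lt with h | h
    · simp [← h]
    · gcongr
      linarith
  have h2 : (ρ * mlog (σ + ε • (1 : Matrix d d ℂ))).trace.re ≤
      (ρ * mlog σ).trace.re + ε * (ρ * mpow σ (-1)).trace.re := by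
    rw [mlog, mlog, mpow, hV.trace_mul_cfc, hV.trace_mul_cfc, (hV.add_smul_one ε).trace_mul_cfc,
      Finset.mul_sum, ← Finset.sum_add_distrib]
    refine Finset.sum_le_sum fun i _ => ?_
    rcases (hV.nonneg hσ i).eq_or_lt with h | h
    · simp [weight_eq_zero hV hs h.symm]
    · have hw := weight_nonneg hρ V i
      -- On the support, regularising changes the logarithm by at most ε/b, hence the error term
      -- with the inverse of `σ`.
      have h3 := Real.log_le_sub_one_of_pos (show 0 < (b i + ε) / b i by positivity)
      rw [Real.log_div (by positivity) h.ne'] at h3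
      have h4 : (b i + ε) / b i - 1 = ε * b i ^ (-1 : ℝ) := by
        rw [Real.rpow_neg_one]; field_simp; ring
      rw [h4] at h3
      nlinarith
  rw [mul_sub, mul_sub, trace_sub, trace_sub, Complex.sub_re, Complex.sub_re]
  linarith

end Log

/-! ### Simultaneous diagonalisation, pinching, and the logarithmic bound. -/

section Pinching

variable {d : Type*} [Fintype d] [DecidableEq d]

lemma HasDiag.submatrix {n : Type*} [Fintype n] [DecidableEq n] {A U : Matrix n n ℂ} {a : n → ℝ}
    (h : HasDiag A U a) (e : d ≃ n) :
    HasDiag (A.submatrix e e) (U.submatrix e e) (fun i => a (e i)) := by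
  constructor
  · rw [mem_unitaryGroup_iff', star_eq_conjTranspose, conjTranspose_submatrix,
      submatrix_mul_equiv, ← star_eq_conjTranspose, h.star_mul_self, submatrix_one_equiv]
  · conv_lhs => rw [h.eq]
    rw [← submatrix_mul_equiv _ _ e e, ← submatrix_mul_equiv _ _ e e, submatrix_diagonal_equiv,
      star_eq_conjTranspose, star_eq_conjTranspose, conjTranspose_submatrix]
    rfl

lemma HasDiag.conj {A V U : Matrix d d ℂ} {a : d → ℝ} (h : HasDiag A V a)
    (hU : U ∈ Matrix.unitaryGroup d ℂ) : HasDiag (U * A * star U) (U * V) a := by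
  refine ⟨mul_mem hU h.unitary, ?_⟩
  conv_lhs => rw [h.eq]
  rw [star_mul]
  simp only [mul_assoc]

/-- Each block is diagonalised separately; a matrix that is scalar on every block stays diagonal in
any such basis. -/
lemma exists_hasDiag_of_blocks {o : Type*} [Fintype o] [DecidableEq o] {m : o → Type*}
    [∀ c, Fintype (m c)] [∀ c, DecidableEq (m c)]
    {E : Matrix (Σ c, m c) (Σ c, m c) ℂ} (hE : E.IsHermitian)
    (h0 : ∀ p q, p.1 ≠ q.1 → E p q = 0) (μ : o → ℝ) :
    ∃ V e, HasDiag E V e ∧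
      HasDiag (diagonal (fun p : Σ c, m c => (μ p.1 : ℂ))) V (fun p => μ p.1) := by
  let B : ∀ c, Matrix (m c) (m c) ℂ := fun c => E.submatrix (Sigma.mk c) (Sigma.mk c)
  have hB : ∀ c, (B c).IsHermitian := fun c => hE.submatrix _
  choose W b hW using fun c => exists_hasDiag (hB c)
  have hEB : E = blockDiagonal' B := by
    ext ⟨c, i⟩ ⟨c', j⟩
    by_cases h : c = c'
    · subst h
      rw [blockDiagonal'_apply_eq]
      rfl
    · rw [blockDiagonal'_apply_ne _ _ _ h]
      exact h0 _ _ h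
  have hV : blockDiagonal' W ∈ Matrix.unitaryGroup (Σ c, m c) ℂ := by
    rw [mem_unitaryGroup_iff', star_eq_conjTranspose, blockDiagonal'_conjTranspose,
      ← blockDiagonal'_mul, ← blockDiagonal'_one]
    congr 1
    ext1 c
    exact (hW c).star_mul_self
  have hg : ∀ (x : ∀ c, Matrix (m c) (m c) ℂ) (y : ∀ c, m c → ℝ),
      (∀ c, HasDiag (x c) (W c) (y c)) →
      HasDiag (blockDiagonal' x) (blockDiagonal' W) (fun p => y p.1 p.2) := by
    intro x y hxy
    refine ⟨hV, ?_⟩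
    have : diagonal (fun p : Σ c, m c => (y p.1 p.2 : ℂ))
        = blockDiagonal' fun c => diagonal (fun i => (y c i : ℂ)) :=
      (blockDiagonal'_diagonal (fun c i => (y c i : ℂ))).symm
    rw [this, star_eq_conjTranspose, blockDiagonal'_conjTranspose, ← blockDiagonal'_mul,
      ← blockDiagonal'_mul]
    congr 1
    ext1 c
    exact (hxy c).eq
  refine ⟨blockDiagonal' W, fun p => b p.1 p.2, ?_, ?_⟩
  · rw [hEB]
    exact hg _ _ hW
  · have := hg (fun c => μ c • (1 : Matrix (m c) (m c) ℂ)) (fun c _ => μ c) fun c => by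
      simpa using (hasDiag_one (hW c).unitary).smul (μ c)
    convert this using 1
    rw [show (fun c => μ c • (1 : Matrix (m c) (m c) ℂ))
      = fun c => diagonal (fun _ : m c => (μ c : ℂ)) from ?_, blockDiagonal'_diagonal]
    ext1 c
    rw [← diagonal_one, ← diagonal_smul]
    congr 1
    ext i
    simp

/-- Commuting Hermitian matrices are simultaneously diagonalisable. -/
lemma exists_hasDiag_of_commute {A B : Matrix d d ℂ} (hA : A.IsHermitian) (hB : B.IsHermitian)
    (hAB : A * B = B * A) : ∃ V a b, HasDiag A V a ∧ HasDiag B V b := by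
  obtain ⟨U, a, hU⟩ := exists_hasDiag hA
  -- Indices are grouped by eigenvalue of `A`; commutation makes `B` block diagonal for this
  -- grouping.
  let lam : d → Set.range a := fun i => ⟨a i, i, rfl⟩
  let e : (Σ c, {i // lam i = c}) ≃ d := Equiv.sigmaFiberEquiv lam
  set B' := star U * B * U with hB'
  have hB'H : B'.IsHermitian := isHermitian_conjTranspose_mul_mul U hB
  have hBB : B = U * B' * star U := by
    rw [hB', show U * (star U * B * U) * star U = (U * star U) * B * (U * star U) by
      simp only [mul_assoc], hU.mul_star_self, one_mul, mul_one]
  have hcomm : diagonal (fun i => (a i : ℂ)) * B' = B' * diagonal (fun i => (a i : ℂ)) := by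
    rw [← hU.star_mul_mul, hB']
    calc _ = star U * A * (U * star U) * B * U := by simp only [mul_assoc]
      _ = star U * (A * B) * U := by rw [hU.mul_star_self]; simp only [mul_assoc, mul_one]
      _ = star U * B * (U * star U) * A * U := by
          rw [hU.mul_star_self, hAB]; simp only [mul_assoc, mul_one]
      _ = _ := by simp only [mul_assoc]
  have hz : ∀ i j, a i ≠ a j → B' i j = 0 := by
    intro i j hij
    have := congrFun (congrFun hcomm i) j
    rw [diagonal_mul, mul_diagonal, mul_comm, ← sub_eq_zero, ← mul_sub] at this
    exact (mul_eq_zero.1 this).resolve_right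
      (sub_ne_zero.2 fun h => hij (Complex.ofReal_injective h))
  obtain ⟨V, b, h1, h2⟩ := exists_hasDiag_of_blocks (hB'H.submatrix e)
    (fun p q hpq => hz _ _ fun h => hpq (by
      obtain ⟨c, i, hi⟩ := p
      obtain ⟨c', j, hj⟩ := q
      exact hi.symm.trans ((Subtype.ext h).trans hj))) (fun c => (c : ℝ))
  have h1' := (h1.submatrix e.symm).conj hU.unitary
  have h2' := (h2.submatrix e.symm).conj hU.unitary
  have hd : (fun p : (Σ c, {i // lam i = c}) => ((p.1 : ℝ) : ℂ)) ∘ e.symm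
      = fun i => (a i : ℂ) := rfl
  rw [submatrix_diagonal_equiv, hd, ← hU.eq] at h2'
  rw [submatrix_submatrix, e.self_comp_symm, submatrix_id_id, ← hBB] at h1'
  exact ⟨_, _, _, h2', h1'⟩

lemma numEigenvalues_eq_card {σ U : Matrix d d ℂ} {a : d → ℝ} (h : HasDiag σ U a) :
    numEigenvalues σ = (Finset.univ.image a).card := by
  have h1 : spectrum ℂ σ = Set.range fun i => (a i : ℂ) := by
    rw [← spectrum_diagonal, h.eq]
    exact Unitary.spectrum_star_right_conjugate (U := ⟨U, h.unitary⟩)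
  rw [numEigenvalues, h1, show (fun i => (a i : ℂ)) = Complex.ofReal ∘ a from rfl, Set.range_comp,
    Set.ncard_image_of_injective _ Complex.ofReal_injective, ← Set.ncard_coe_finset]
  simp

/-- The pinching inequality. -/
lemma le_card_smul_sum_pinching {ι : Type*} [Fintype ι] {ρ : Matrix d d ℂ} (hρ : ρ.PosSemidef)
    {Q : ι → Matrix d d ℂ} (hQ : ∀ c, (Q c).IsHermitian) (hsum : ∑ c, Q c = 1) :
    ρ ≤ (Fintype.card ι : ℝ) • ∑ c, Q c * ρ * Q c := by
  -- The cross terms add up to `ρ` since the `Q c` sum to one, so this positive sum is twice the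
  -- difference in the claim.
  have h1 : (∑ c, ∑ c', (Q c - Q c') * ρ * (Q c - Q c')).PosSemidef := by
    refine posSemidef_sum _ fun c _ => posSemidef_sum _ fun c' _ => ?_
    have := hρ.mul_mul_conjTranspose_same (Q c - Q c')
    rwa [((hQ c).sub (hQ c')).eq] at this
  have h2 : ∑ c, ∑ c', (Q c - Q c') * ρ * (Q c - Q c')
      = (2 : ℝ) • ((Fintype.card ι : ℝ) • ∑ c, Q c * ρ * Q c - ρ) := by
    have e1 : ∑ c, ∑ c', Q c * ρ * Q c' = ρ := by
      simp_rw [← Finset.mul_sum, hsum, mul_one, ← Finset.sum_mul, hsum, one_mul]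
    have e2 : ∑ c, ∑ c', Q c' * ρ * Q c = ρ := by rw [Finset.sum_comm]; exact e1
    simp_rw [sub_mul, mul_sub, Finset.sum_sub_distrib, Finset.sum_const, e1, e2,
      Finset.card_univ, ← Finset.smul_sum]
    rw [Nat.cast_smul_eq_nsmul ℝ]
    rw [two_smul]
    abel
  rw [h2] at h1
  rw [Matrix.le_iff]
  have := h1.smul (show (0 : ℝ) ≤ 1 / 2 by norm_num)
  rwa [smul_smul, show (1 / 2 : ℝ) * 2 = 1 by norm_num, one_smul] at this

/-- The pinching of `ρ` with respect to `σ`, diagonalised together with `σ`. -/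
lemma exists_pinching {ρ σ : Matrix d d ℂ} (hρ : ρ.PosSemidef) (hσ : σ.IsHermitian) :
    ∃ V lam E, HasDiag σ V lam ∧ HasDiag E V (weight ρ V) ∧
      ρ ≤ (numEigenvalues σ : ℝ) • E := by
  obtain ⟨U, a, hU⟩ := exists_hasDiag hσ
  obtain ⟨S, hS⟩ : ∃ S, S = Finset.univ.image a := ⟨_, rfl⟩
  let χ : S → ℝ → ℝ := fun c x => if x = c then 1 else 0
  let Q : S → Matrix d d ℂ := fun c => cfc (χ c) σ
  have hQ : ∀ c, HasDiag (Q c) U (fun i => χ c (a i)) := fun c => hU.cfc _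
  have hQH : ∀ c, (Q c).IsHermitian := fun c => (hQ c).isHermitian
  have hχ : ∀ i, ∑ c : S, χ c (a i) = 1 := by
    intro i
    rw [Finset.sum_eq_single ⟨a i, hS ▸ Finset.mem_image_of_mem _ (Finset.mem_univ i)⟩]
    · simp [χ]
    · intro c _ hc
      simp only [χ, ite_eq_right_iff, one_ne_zero, imp_false]
      exact fun h => hc (Subtype.ext h.symm)
    · simp
  have hsum : ∑ c, Q c = 1 := by
    have e : ∀ c, Q c = U * diagonal (fun i => ((χ c (a i) : ℝ) : ℂ)) * star U :=
      fun c => (hQ c).eq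
    have e2 : ∑ c : S, diagonal (fun i => ((χ c (a i) : ℝ) : ℂ)) = (1 : Matrix d d ℂ) := by
      ext i j
      rw [Matrix.sum_apply]
      by_cases h : i = j
      · subst h
        simp only [diagonal_apply_eq, one_apply_eq]
        exact_mod_cast hχ i
      · simp [h]
    simp_rw [e, ← Finset.sum_mul, ← Finset.mul_sum, e2, mul_one, hU.mul_star_self]
  set E := ∑ c, Q c * ρ * Q c with hE
  have hEH : E.IsHermitian := by
    refine (posSemidef_sum _ fun c _ => ?_).1
    have := hρ.mul_mul_conjTranspose_same (Q c)
    rwa [(hQH c).eq] at this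
  have hQσ : ∀ c, Q c * σ = (c : ℝ) • Q c := by
    intro c
    refine (((hQ c).mul hU).congr fun i => ?_).ext ((hQ c).smul c)
    simp only [χ]; split_ifs with h <;> simp [h]
  have hσQ : ∀ c, σ * Q c = (c : ℝ) • Q c := by
    intro c
    refine ((hU.mul (hQ c)).congr fun i => ?_).ext ((hQ c).smul c)
    simp only [χ]; split_ifs with h <;> simp [h]
  have hcomm : σ * E = E * σ := by
    rw [hE, Finset.mul_sum, Finset.sum_mul]
    refine Finset.sum_congr rfl fun c _ => ?_
    rw [mul_assoc (Q c * ρ), hQσ, ← mul_assoc, ← mul_assoc, hσQ]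
    simp
  obtain ⟨V, lam, e, hVσ, hVE⟩ := exists_hasDiag_of_commute hσ hEH hcomm
  refine ⟨V, lam, E, hVσ, hVE.congr fun i => ?_, ?_⟩
  -- Each `Q c` is a 0/1 diagonal matrix in the basis `V`, and exactly one of them is 1 at `i`.
  -- Pinching therefore keeps the diagonal of `ρ` in this basis, and these entries are the
  -- eigenvalues of `E`.
  · rw [← hVE.weight_self i]
    have hlam : ∑ c : S, χ c (lam i) = 1 := by
      have hV1 : ∀ c, HasDiag (Q c) V (fun i => χ c (lam i)) := fun c => hVσ.cfc _
      have h1 := congrArg (fun A => weight A V i) hsum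
      simp only [(hasDiag_one hVσ.unitary).weight_self] at h1
      rw [← h1, weight, Finset.mul_sum, Finset.sum_mul, Matrix.sum_apply, Complex.re_sum]
      exact Finset.sum_congr rfl fun c _ => ((hV1 c).weight_self i).symm
    have h2 : ∀ c, ((star V * (Q c * ρ * Q c) * V) i i).re = χ c (lam i) * weight ρ V i := by
      intro c
      have hV1 : HasDiag (Q c) V (fun i => χ c (lam i)) := hVσ.cfc _
      have e3 : star V * (Q c * ρ * Q c) * V =
          (star V * Q c * V) * (star V * ρ * V) * (star V * Q c * V) := by
        calc _ = star V * Q c * 1 * ρ * 1 * Q c * V := by simp only [mul_assoc, mul_one]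
          _ = _ := by rw [← hVσ.mul_star_self]; simp only [mul_assoc]
      rw [e3, hV1.star_mul_mul, mul_diagonal, diagonal_mul, weight]
      have : χ c (lam i) = 0 ∨ χ c (lam i) = 1 := by
        simp only [χ]; split_ifs <;> simp
      rcases this with h | h <;> simp [h]
    rw [weight, hE, Finset.mul_sum, Finset.sum_mul, Matrix.sum_apply, Complex.re_sum,
      Finset.sum_congr rfl fun c _ => h2 c, ← Finset.sum_mul, hlam, one_mul]
  · have := le_card_smul_sum_pinching hρ hQH hsum
    have hcard : S.card = numEigenvalues σ := by rw [numEigenvalues_eq_card hU, hS]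
    rwa [Fintype.card_coe, hcard] at this

/-- Jensen's inequality for the diagonal of a power. -/
lemma weight_rpow_le {ρ V : Matrix d d ℂ} (hρ : ρ.PosSemidef)
    (hV : V ∈ Matrix.unitaryGroup d ℂ) {t : ℝ} (ht : 1 ≤ t) (i : d) :
    weight ρ V i ^ t ≤ weight (mpow ρ t) V i := by
  obtain ⟨U, a, hU⟩ := exists_hasDiag hρ.1
  rw [weight_eq_sum_overlap hU, weight_eq_sum_overlap (show HasDiag (mpow ρ t) U (fun i => a i ^ t) from hU.cfc _)]
  have := (convexOn_rpow ht).map_sum_le (t := Finset.univ) (w := fun j => overlap U V j i)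
    (p := a) (fun j _ => overlap_nonneg U V j i) (sum_overlap_left hU.unitary hV i)
    (fun j _ => hU.nonneg hρ j)
  simp only [smul_eq_mul] at this
  simpa only [mul_comm] using this

/-- Combines (1 + x)^s ≤ 1 + x^s with log(1 + y) ≤ y; this is the source of the factor 1/s. -/
lemma log_one_add_le_rpow_div {x s : ℝ} (hx : 0 ≤ x) (hs0 : 0 < s) (hs1 : s ≤ 1) :
    Real.log (1 + x) ≤ x ^ s / s := by
  have h1 : s * Real.log (1 + x) ≤ x ^ s := by
    rw [← Real.log_rpow (by positivity)]
    calc _ ≤ Real.log (1 + x ^ s) := by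
          gcongr
          simpa using Real.rpow_add_le_add_rpow zero_le_one hx hs0.le hs1
      _ ≤ _ := by
          have := Real.log_le_sub_one_of_pos (show 0 < 1 + x ^ s by positivity)
          linarith
  rwa [le_div_iff₀ hs0, mul_comm]

/-- Pinching dominates the mixture by a matrix commuting with `σ`, so the difference of logarithms
is scalar: at most (vp)^s w^s λ^{-s}/s, with `w` the diagonal entries of `ρ` in the common basis.
Jensen's inequality then passes from w^{1+s} to the diagonal of ρ^{1+s}. -/
lemma trace_mul_mlog_sub_le_of_nonneg {ρ σ : Matrix d d ℂ} (hρ : IsDensity ρ)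
    (hσ : IsDensity σ) (hs : SuppLE ρ σ) {α p s ε : ℝ} (hs0 : 0 < s) (hs1 : s ≤ 1)
    (hε : 0 < ε) (hα0 : 0 ≤ α) (hα : α ≤ p) (hp1 : p ≤ 1) :
    (ρ * (mlog (α • ρ + (1 - α) • σ + ε • (1 : Matrix d d ℂ))
      - mlog (σ + ε • (1 : Matrix d d ℂ)))).trace.re ≤
      ((numEigenvalues σ : ℝ) * p) ^ s / s * (mpow ρ (1 + s) * mpow σ (-s)).trace.re := by
  obtain ⟨V, lam, E, hVσ, hVE, hle⟩ := exists_pinching hρ.1 hσ.1.1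
  set v : ℝ := (numEigenvalues σ : ℝ) with hv
  have hv0 : 0 ≤ v := Nat.cast_nonneg _
  have hp0 : 0 ≤ p := hα0.trans hα
  have hlam := hVσ.nonneg hσ.1
  have hw := weight_nonneg hρ.1 V
  have hEpos := hVE.posSemidef_of_nonneg hw
  have hMpos : (α • ρ + (1 - α) • σ).PosSemidef :=
    (hρ.1.smul hα0).add (hσ.1.smul (by linarith))
  have hbig := ((hVσ.add (hVE.smul (v * p))).add_smul_one ε)
  have hM : α • ρ + (1 - α) • σ + ε • (1 : Matrix d d ℂ)
      ≤ σ + (v * p) • E + ε • (1 : Matrix d d ℂ) := by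
    rw [Matrix.le_iff] at hle ⊢
    -- The difference is p(vE - ρ) + (p - α)ρ + ασ.
    have h1 := ((hle.smul hp0).add (hρ.1.smul (sub_nonneg.2 hα))).add (hσ.1.smul hα0)
    convert h1 using 1
    module
  have h1 : (ρ * mlog (α • ρ + (1 - α) • σ + ε • (1 : Matrix d d ℂ))).trace.re ≤
      ∑ i, weight ρ V i * Real.log (lam i + v * p * weight ρ V i + ε) := by
    rw [← hbig.trace_mul_cfc ρ Real.log]
    exact trace_mul_mono hρ.1 (mlog_mono (posDef_add_smul_one hMpos hε) hM)
  have h2 : (ρ * mlog (σ + ε • (1 : Matrix d d ℂ))).trace.re =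
      ∑ i, weight ρ V i * Real.log (lam i + ε) := (hVσ.add_smul_one ε).trace_mul_cfc ρ Real.log
  have h3 : (mpow ρ (1 + s) * mpow σ (-s)).trace.re =
      ∑ i, weight (mpow ρ (1 + s)) V i * lam i ^ (-s) := hVσ.trace_mul_cfc _ _
  rw [mul_sub, trace_sub, Complex.sub_re, h2, h3]
  refine (sub_le_sub_right h1 _).trans ?_
  rw [← Finset.sum_sub_distrib, Finset.mul_sum]
  refine Finset.sum_le_sum fun i _ => ?_
  have hwi := hw i
  have hJ := weight_rpow_le hρ.1 hVσ.unitary (show 1 ≤ 1 + s by linarith) i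
  rcases (hlam i).eq_or_lt with h | h
  · rw [weight_eq_zero hVσ hs h.symm, zero_mul, zero_mul, sub_zero]
    have := weight_nonneg (posSemidef_mpow hρ.1 (1 + s)) V i
    have := hlam i
    positivity
  · have h4 : Real.log (lam i + v * p * weight ρ V i + ε) - Real.log (lam i + ε) ≤
        (v * p) ^ s * weight ρ V i ^ s * lam i ^ (-s) / s := by
      rw [← Real.log_div (by positivity) (by positivity)]
      have e : (lam i + v * p * weight ρ V i + ε) / (lam i + ε)
          = 1 + v * p * weight ρ V i / (lam i + ε) := by field_simp; ring
      rw [e]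
      refine (log_one_add_le_rpow_div (by positivity) hs0 hs1).trans ?_
      gcongr
      calc _ ≤ (v * p * weight ρ V i / lam i) ^ s := by
            gcongr
            linarith
        _ = _ := by
            rw [Real.div_rpow (by positivity) h.le, Real.mul_rpow (by positivity) hwi,
              Real.rpow_neg h.le, div_eq_mul_inv]
    calc _ = weight ρ V i *
          (Real.log (lam i + v * p * weight ρ V i + ε) - Real.log (lam i + ε)) := by ring
      _ ≤ weight ρ V i * ((v * p) ^ s * weight ρ V i ^ s * lam i ^ (-s) / s) := by gcongr
      _ = (v * p) ^ s / s * (weight ρ V i ^ (1 + s) * lam i ^ (-s)) := by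
          rw [Real.rpow_add' hwi (by linarith), Real.rpow_one]; ring
      _ ≤ _ := by gcongr

lemma trace_mul_mlog_sub_le {ρ σ : Matrix d d ℂ} (hρ : IsDensity ρ)
    (hσ : IsDensity σ) (hs : SuppLE ρ σ) {α p s ε : ℝ} (hs0 : 0 < s) (hs1 : s ≤ 1)
    (hε : 0 < ε) (hp0 : 0 ≤ p) (hp1 : p ≤ 1) (hα : α ≤ p)
    (hM : (α • ρ + (1 - α) • σ).PosSemidef) :
    (ρ * (mlog (α • ρ + (1 - α) • σ + ε • (1 : Matrix d d ℂ))
      - mlog (σ + ε • (1 : Matrix d d ℂ)))).trace.re ≤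
      ((numEigenvalues σ : ℝ) * p) ^ s / s * (mpow ρ (1 + s) * mpow σ (-s)).trace.re
        + |α| * Fintype.card d * ε := by
  have h0 : 0 ≤ (mpow ρ (1 + s) * mpow σ (-s)).trace.re :=
    trace_mul_re_nonneg (posSemidef_mpow hρ.1 _) (posSemidef_mpow hσ.1 _)
  rcases le_or_gt 0 α with h | h
  · have := trace_mul_mlog_sub_le_of_nonneg hρ hσ hs hs0 hs1 hε h hα hp1
    have : 0 ≤ |α| * Fintype.card d * ε := by positivity
    linarith
  · have h1 := trace_mul_mlog_sub_le_of_neg hρ hσ hε h hM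
    rw [abs_of_neg h]
    have : 0 ≤ ((numEigenvalues σ : ℝ) * p) ^ s / s * (mpow ρ (1 + s) * mpow σ (-s)).trace.re := by
      positivity
    linarith

end Pinching

/-! ### Block diagonal form of classical-quantum states. -/

section Channel

variable {X d : Type*} [Fintype X] [DecidableEq X] [Fintype d] [DecidableEq d]

/-- The block diagonal embedding, as an algebra homomorphism. -/
def blockHom (X d : Type*) [Fintype X] [DecidableEq X] [Fintype d] [DecidableEq d] :
    (X → Matrix d d ℂ) →ₐ[ℝ] Matrix (X × d) (X × d) ℂ where
  toFun A := of fun p q => if p.1 = q.1 then A p.1 p.2 q.2 else 0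
  map_one' := by
    ext ⟨x, k⟩ ⟨y, l⟩
    by_cases h : x = y <;> simp [h, one_apply]
  map_zero' := by
    ext ⟨x, k⟩ ⟨y, l⟩
    simp
  map_add' A B := by
    ext ⟨x, k⟩ ⟨y, l⟩
    by_cases h : x = y <;> simp [h]
  map_mul' A B := by
    ext ⟨x, k⟩ ⟨y, l⟩
    simp only [of_apply, Pi.mul_apply, Matrix.mul_apply, Fintype.sum_prod_type]
    rw [Finset.sum_eq_single x]
    · by_cases h : x = y <;> simp [h]
    · intro z _ hz
      simp [hz.symm]
    · simp
  commutes' c := by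
    ext ⟨x, k⟩ ⟨y, l⟩
    by_cases h : x = y <;> simp [h, algebraMap_matrix_apply]

lemma blockHom_apply (A : X → Matrix d d ℂ) (p q : X × d) :
    blockHom X d A p q = if p.1 = q.1 then A p.1 p.2 q.2 else 0 := rfl

lemma trace_blockHom (A : X → Matrix d d ℂ) : (blockHom X d A).trace = ∑ x, (A x).trace := by
  simp [trace, Fintype.sum_prod_type, blockHom_apply]

lemma isHermitian_blockHom {A : X → Matrix d d ℂ} (hA : ∀ x, (A x).IsHermitian) :
    (blockHom X d A).IsHermitian := by
  ext ⟨x, k⟩ ⟨y, l⟩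
  by_cases h : x = y
  · subst h
    simpa [blockHom_apply, conjTranspose_apply] using (hA x).apply k l
  · simp [blockHom_apply, conjTranspose_apply, h, Ne.symm h]

/-- A single polynomial interpolates `f` on the spectra of the big matrix and of all blocks, and
polynomials commute with algebra homomorphisms. -/
lemma cfc_blockHom {A : X → Matrix d d ℂ} (hA : ∀ x, (A x).IsHermitian) (f : ℝ → ℝ) :
    cfc f (blockHom X d A) = blockHom X d (fun x => cfc f (A x)) := by
  obtain ⟨q, hq⟩ := exists_polynomial_eq_on
    ((blockHom X d A).finite_real_spectrum.union
      (Set.finite_iUnion fun x => (A x).finite_real_spectrum)) f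
  have h1 : cfc f (blockHom X d A) = Polynomial.aeval (blockHom X d A) q := by
    rw [← cfc_polynomial q _ (isHermitian_blockHom hA)]
    exact cfc_congr fun x hx => (hq x (Or.inl hx)).symm
  rw [h1, Polynomial.aeval_algHom_apply]
  congr 1
  ext1 x
  have h2 : cfc f (A x) = Polynomial.aeval (A x) q := by
    rw [← cfc_polynomial q _ (hA x)]
    exact cfc_congr fun y hy => (hq y (Or.inr (Set.mem_iUnion.2 ⟨x, hy⟩))).symm
  rw [h2]
  exact (Polynomial.aeval_algHom_apply
    (Pi.evalAlgHom ℝ (fun _ : X => Matrix d d ℂ) x) A q).symm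

lemma mpow_smul {A : Matrix d d ℂ} (hA : A.PosSemidef) {c : ℝ} (hc : 0 ≤ c) (t : ℝ) :
    mpow (c • A) t = c ^ t • mpow A t := by
  obtain ⟨U, a, h⟩ := exists_hasDiag hA.1
  refine (((h.smul c).cfc (· ^ t)).congr fun i => ?_).ext ((h.cfc (· ^ t)).smul (c ^ t))
  exact Real.mul_rpow hc (h.nonneg hA i)

lemma sandwich_smul_smul {A B : Matrix d d ℂ} (hB : B.PosSemidef) {c : ℝ} (hc : 0 < c) :
    sandwich (c • A) (c • B) = sandwich A B := by
  have h : c ^ (-1 / 2 : ℝ) * (c ^ (-1 / 2 : ℝ) * c) = 1 := by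
    nth_rw 3 [← Real.rpow_one c]
    rw [← Real.rpow_add hc, ← Real.rpow_add hc]; norm_num
  rw [sandwich, mpow_smul hB hc.le, sandwich]
  simp only [smul_mul_assoc, mul_smul_comm, smul_smul]
  rw [show c ^ (-1 / 2 : ℝ) * (c * c ^ (-1 / 2 : ℝ)) = 1 by linear_combination h,
    one_smul]

lemma sandwich_blockHom {A B : X → Matrix d d ℂ} (hB : ∀ x, (B x).IsHermitian) :
    sandwich (blockHom X d A) (blockHom X d B) = blockHom X d (fun x => sandwich (A x) (B x)) := by
  rw [sandwich, mpow, cfc_blockHom hB, ← map_mul, ← map_mul]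
  rfl

lemma cqState_eq (W : X → Matrix d d ℂ) (p : X → ℝ) :
    cqState W p = blockHom X d (fun x => p x • W x) := by
  ext ⟨x, k⟩ ⟨y, l⟩
  rw [cqState, Matrix.sum_apply, blockHom_apply]
  rw [Finset.sum_eq_single x]
  · by_cases h : x = y <;> simp [kroneckerMap_apply, h]
  · intro z _ hz
    simp [kroneckerMap_apply, hz]
  · simp

lemma marginal_kronecker_eq {W : X → Matrix d d ℂ} (hW : ∀ x, IsDensity (W x)) (p : X → ℝ) :
    marginalA (cqState W p) ⊗ₖ marginalE (cqState W p)
      = blockHom X d (fun x => p x • output W p) := by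
  have hA : marginalA (cqState W p) = diagonal fun x => (p x : ℂ) := by
    ext x y
    rw [marginalA, cqState_eq]
    by_cases h : x = y
    · subst h
      have := (hW x).2
      rw [trace] at this
      simp only [diag_apply] at this
      simp [blockHom_apply, ← Finset.mul_sum, this]
    · simp [blockHom_apply, h]
  have hE : marginalE (cqState W p) = output W p := by
    ext k l
    rw [marginalE, cqState_eq, output, Matrix.sum_apply]
    simp [blockHom_apply]
  rw [hA, hE]
  ext ⟨x, k⟩ ⟨y, l⟩
  by_cases h : x = y <;> simp [kroneckerMap_apply, blockHom_apply, h]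

lemma posSemidef_output {W : X → Matrix d d ℂ} (hW : ∀ x, IsDensity (W x)) {p : X → ℝ}
    (hp : ∀ x, 0 ≤ p x) : (output W p).PosSemidef :=
  posSemidef_sum _ fun x _ => (hW x).1.smul (hp x)

lemma isDensity_output {W : X → Matrix d d ℂ} (hW : ∀ x, IsDensity (W x)) {p : X → ℝ}
    (hp : p ∈ stdSimplex ℝ X) : IsDensity (output W p) := by
  refine ⟨posSemidef_output hW hp.1, ?_⟩
  rw [output, trace_sum]
  simp_rw [trace_smul, (hW _).2]
  rw [← Finset.sum_smul, hp.2, one_smul]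

lemma unif_mem_stdSimplex [Nonempty X] : unif X ∈ stdSimplex ℝ X :=
  ⟨fun x => by simp [unif], by simp [unif]⟩

lemma suppLE_output {W : X → Matrix d d ℂ} (hW : ∀ x, IsDensity (W x)) {p : X → ℝ}
    (hp : ∀ x, 0 < p x) (x : X) : SuppLE (W x) (output W p) := by
  intro v hv
  have h1 : star v ⬝ᵥ (output W p *ᵥ v) = 0 := by simp [hv]
  have h2 : star v ⬝ᵥ (output W p *ᵥ v) = ∑ x, p x • (star v ⬝ᵥ (W x *ᵥ v)) := by
    rw [output, sum_mulVec, dotProduct_sum]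
    simp_rw [smul_mulVec, dotProduct_smul]
  rw [h2, Finset.sum_eq_zero_iff_of_nonneg fun x _ =>
    smul_nonneg (hp x).le ((hW x).1.dotProduct_mulVec_nonneg v)] at h1
  have h3 := (smul_eq_zero.1 (h1 x (Finset.mem_univ _))).resolve_left (hp x).ne'
  exact ((hW x).1.dotProduct_mulVec_zero_iff v).1 h3

lemma suppLE_output_of_forall {W : X → Matrix d d ℂ} {σ : Matrix d d ℂ}
    (h : ∀ x, SuppLE (W x) σ) (p : X → ℝ) : SuppLE (output W p) σ := by
  intro v hv
  rw [output, sum_mulVec]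
  exact Finset.sum_eq_zero fun x _ => by rw [smul_mulVec, h x v hv, smul_zero]

/-- Both states are block diagonal, and each block carries (1/|X|)^{1+s} (1/|X|)^{-s} = 1/|X|. -/
lemma psiChannel_unif [Nonempty X] {W : X → Matrix d d ℂ} (hW : ∀ x, IsDensity (W x))
    {s : ℝ} :
    psiChannel s W (unif X) = Real.log ((1 / (Fintype.card X : ℝ)) *
      ∑ x, (mpow (W x) (1 + s) * mpow (output W (unif X)) (-s)).trace.re) := by
  have hc : (0 : ℝ) < 1 / (Fintype.card X : ℝ) := by
    have := Fintype.card_pos (α := X); positivity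
  have hσ := (isDensity_output hW unif_mem_stdSimplex).1
  rw [psiChannel, psi, marginal_kronecker_eq hW, cqState_eq, mpow, mpow,
    cfc_blockHom fun x => ((hW x).1.smul (unif_mem_stdSimplex.1 x)).1,
    cfc_blockHom fun x => (hσ.smul (unif_mem_stdSimplex.1 x)).1, ← map_mul, trace_blockHom]
  congr 1
  rw [Complex.re_sum, Finset.mul_sum]
  refine Finset.sum_congr rfl fun x _ => ?_
  change (mpow (unif X x • W x) (1 + s) * mpow (unif X x • output W (unif X)) (-s)).trace.re = _
  rw [mpow_smul (hW x).1 (unif_mem_stdSimplex.1 x), mpow_smul hσ (unif_mem_stdSimplex.1 x),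
    smul_mul_assoc, mul_smul_comm, smul_smul, trace_smul, Complex.smul_re, smul_eq_mul, unif,
    ← Real.rpow_add hc]
  simp

/-- The factor 1/|X| cancels inside the sandwich and survives only in the outer state. -/
lemma psiLowChannel_unif [Nonempty X] {W : X → Matrix d d ℂ} (hW : ∀ x, IsDensity (W x))
    {s : ℝ} :
    psiLowChannel s W (unif X) = Real.log ((1 / (Fintype.card X : ℝ)) *
      ∑ x, (W x * mpow (sandwich (W x) (output W (unif X))) s).trace.re) := by
  have hc : (0 : ℝ) < 1 / (Fintype.card X : ℝ) := by
    have := Fintype.card_pos (α := X); positivity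
  have hσ := (isDensity_output hW unif_mem_stdSimplex).1
  have hp := (unif_mem_stdSimplex (X := X)).1
  rw [psiLowChannel, psiLow, marginal_kronecker_eq hW, cqState_eq,
    sandwich_blockHom fun x => (hσ.smul (hp x)).1, mpow,
    cfc_blockHom fun x => (posSemidef_sandwich ((hW x).1.smul (hp x)) (hσ.smul (hp x))).1,
    ← map_mul, trace_blockHom]
  congr 1
  rw [Complex.re_sum, Finset.mul_sum]
  refine Finset.sum_congr rfl fun x _ => ?_
  simp only [Pi.mul_apply]
  rw [sandwich_smul_smul hσ (show 0 < unif X x from hc), smul_mul_assoc, trace_smul,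
    Complex.smul_re, smul_eq_mul]
  rfl

end Channel

/-! ### Averaging over the random embedding and shift. -/

section Decoupling

/-- The law `r` of a random injective homomorphism `A → X` whose values at nonzero points are
at most uniformly distributed on `X \ {0}`. -/
structure IsRandomEmbedding {A X : Type*} [AddCommGroup A] [AddCommGroup X] [Fintype X]
    [DecidableEq X] [Fintype (A → X)] (r : (A → X) → ℝ) : Prop where
  nonneg : ∀ g, 0 ≤ r g
  sum_eq_one : ∑ g, r g = 1
  injective : ∀ g, r g ≠ 0 → Function.Injective g
  map_sub : ∀ g, r g ≠ 0 → ∀ a b, g (a - b) = g a - g b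
  le_unif : ∀ x : X, x ≠ 0 → ∀ a : A, a ≠ 0 →
    ∑ g with g a = x, r g ≤ 1 / ((Fintype.card X : ℝ) - 1)

variable {A X : Type*} [AddCommGroup A] [AddCommGroup X] [Fintype A] [Fintype X]
  [DecidableEq X] [Fintype (A → X)] {r : (A → X) → ℝ}

namespace IsRandomEmbedding

lemma prob_zero (h : IsRandomEmbedding r) {a : A} (ha : a ≠ 0) :
    ∑ g with g a = 0, r g = 0 := by
  refine Finset.sum_eq_zero fun g hg => ?_
  by_contra hr
  have h0 : g 0 = 0 := by simpa using h.map_sub g hr 0 0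
  exact ha (h.injective g hr ((Finset.mem_filter.1 hg).2.trans h0.symm))

/-- The distribution bound is attained, as the probabilities add up to one. -/
lemma prob_eq (h : IsRandomEmbedding r) {a : A} (ha : a ≠ 0) {x : X} (hx : x ≠ 0) :
    ∑ g with g a = x, r g = 1 / ((Fintype.card X : ℝ) - 1) := by
  have hX : 1 < Fintype.card X := Fintype.one_lt_card_iff.2 ⟨x, 0, hx⟩
  have hX' : (1 : ℝ) < Fintype.card X := by exact_mod_cast hX
  have h1 : ∑ z ∈ Finset.univ.erase (0 : X), ∑ g with g a = z, r g
      = ∑ z ∈ Finset.univ.erase (0 : X), 1 / ((Fintype.card X : ℝ) - 1) := by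
    have h2 := Finset.sum_fiberwise Finset.univ (fun g : A → X => g a) r
    rw [h.sum_eq_one, ← Finset.add_sum_erase _ _ (Finset.mem_univ (0 : X)), h.prob_zero ha,
      zero_add] at h2
    rw [h2, Finset.sum_const, Finset.card_erase_of_mem (Finset.mem_univ _), Finset.card_univ,
      nsmul_eq_mul, Nat.cast_sub hX.le]
    have : (Fintype.card X : ℝ) - 1 ≠ 0 := by linarith
    simp [this]
  exact (Finset.sum_eq_sum_iff_of_le fun z hz => h.le_unif z (Finset.ne_of_mem_erase hz) a ha).1 h1
    x (Finset.mem_erase.2 ⟨hx, Finset.mem_univ _⟩)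

variable {V : Type*} [AddCommGroup V] [Module ℝ V]

/-- The image of `a` is uniform on the nonzero elements, so its translate by `x` is uniform on the
complement of `x`. -/
lemma sum_smul_translate (h : IsRandomEmbedding r) {a : A} (ha : a ≠ 0) (w : X → V) (x : X) :
    ∑ g, r g • w (x + g a) = (1 / ((Fintype.card X : ℝ) - 1)) • (∑ z, w z - w x) := by
  rw [← Finset.sum_fiberwise Finset.univ (fun g : A → X => g a)]
  have h1 : ∀ z : X, ∑ g with g a = z, r g • w (x + g a)
      = (∑ g with g a = z, r g) • w (x + z) := by
    intro z
    rw [Finset.sum_smul]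
    exact Finset.sum_congr rfl fun g hg => by rw [(Finset.mem_filter.1 hg).2]
  simp_rw [h1]
  rw [← Finset.add_sum_erase _ _ (Finset.mem_univ (0 : X)), h.prob_zero ha, zero_smul, zero_add,
    Finset.sum_congr rfl fun z hz => by rw [h.prob_eq ha (Finset.ne_of_mem_erase hz)],
    ← Finset.smul_sum, ← Equiv.sum_comp (Equiv.addLeft x) w,
    ← Finset.add_sum_erase _ _ (Finset.mem_univ (0 : X))]
  simp

/-- The weight of `x` in the conditional mean output, given that `a` is mapped to `x`. -/
noncomputable def _root_.CQ.condCoeff (X : Type*) [Fintype X] (p : ℝ) : ℝ :=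
  (Fintype.card X * p - 1) / ((Fintype.card X : ℝ) - 1)

lemma _root_.CQ.condCoeff_le (X : Type*) [Fintype X] [Nonempty X] {p : ℝ} (hp0 : 0 ≤ p)
    (hp1 : p ≤ 1) : condCoeff X p ≤ p := by
  have hX : (1 : ℝ) ≤ Fintype.card X := by exact_mod_cast Fintype.card_pos (α := X)
  rw [condCoeff]
  rcases hX.eq_or_lt with h | h
  -- For |X| = 1 the denominator is 0 and the coefficient takes the default value 0.
  · rw [← h]; simpa using hp0
  · rw [div_le_iff₀ (by linarith)]; nlinarith

/-- The conditional mean output. -/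
lemma condMean (h : IsRandomEmbedding r) {P : A → ℝ} (hP : P ∈ stdSimplex ℝ A) (w : X → V)
    (a : A) (x : X) :
    ∑ g, r g • ∑ b, P b • w (x + g (b - a)) =
      condCoeff X (P a) • w x + (1 - condCoeff X (P a)) • ∑ z, (1 / (Fintype.card X : ℝ)) • w z := by
  classical
  have hX : 1 ≤ Fintype.card X := Fintype.card_pos_iff.2 ⟨0⟩
  rcases hX.eq_or_lt with h1 | h1
  · have hsub : Subsingleton X := (Fintype.card_le_one_iff_subsingleton).1 h1.symm.le
    have hw : ∀ z, w z = w x := fun z => congrArg w (Subsingleton.elim z x)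
    simp_rw [hw, ← Finset.sum_smul, hP.2, one_smul, h.sum_eq_one]
    simp [← h1, ← add_smul]
  · have hX' : (Fintype.card X : ℝ) - 1 ≠ 0 := by
      have : (1 : ℝ) < Fintype.card X := by exact_mod_cast h1
      linarith
    have hX0 : (Fintype.card X : ℝ) ≠ 0 := by
      have : (1 : ℝ) < Fintype.card X := by exact_mod_cast h1
      linarith
    simp_rw [Finset.smul_sum (s := (Finset.univ : Finset A))]
    rw [Finset.sum_comm, ← Finset.add_sum_erase _ _ (Finset.mem_univ a)]
    -- Only `b = a` contributes the fixed point `x`; every other `b` gives the uniform average off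
    -- `x`.
    have e1 : ∑ g, r g • P a • w (x + g (a - a)) = P a • w x := by
      have : ∀ g, r g • P a • w (x + g (a - a)) = r g • P a • w x := by
        intro g
        by_cases hr : r g = 0
        · simp [hr]
        · rw [h.map_sub g hr, sub_self, add_zero]
      simp_rw [this, ← Finset.sum_smul, h.sum_eq_one, one_smul]
    have e2 : ∀ b ∈ Finset.univ.erase a, ∑ g, r g • P b • w (x + g (b - a))
        = P b • (1 / ((Fintype.card X : ℝ) - 1)) • (∑ z, w z - w x) := by
      intro b hb
      rw [← h.sum_smul_translate (sub_ne_zero.2 (Finset.ne_of_mem_erase hb)), Finset.smul_sum]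
      exact Finset.sum_congr rfl fun g _ => smul_comm _ _ _
    have e3 : ∑ b ∈ Finset.univ.erase a, P b = 1 - P a := by
      rw [← hP.2, ← Finset.add_sum_erase _ _ (Finset.mem_univ a)]; ring
    rw [e1, Finset.sum_congr rfl e2, ← Finset.sum_smul, e3, ← Finset.smul_sum]
    have c1 : condCoeff X (P a) = P a - (1 - P a) * (1 / ((Fintype.card X : ℝ) - 1)) := by
      rw [condCoeff]; field_simp; ring
    have c2 : (1 - condCoeff X (P a)) * (1 / (Fintype.card X : ℝ))
        = (1 - P a) * (1 / ((Fintype.card X : ℝ) - 1)) := by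
      rw [condCoeff]; field_simp; ring
    rw [smul_smul, smul_smul, c2, c1]
    module

end IsRandomEmbedding

variable {d : Type*} [Fintype d] [DecidableEq d]

lemma output_pushforward (W : X → Matrix d d ℂ) (P : A → ℝ) (g : A → X) :
    output W (pushforward P g) = ∑ a, P a • W (g a) := by
  simp_rw [output, pushforward, Finset.sum_smul]
  rw [← Finset.sum_fiberwise Finset.univ g]
  exact Finset.sum_congr rfl fun x _ => Finset.sum_congr rfl fun a ha => by
    rw [(Finset.mem_filter.1 ha).2]

/-- Averaging over the random shift and embedding, and Jensen's operator inequality. -/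
lemma IsRandomEmbedding.sum_trace_le (h : IsRandomEmbedding r) {P : A → ℝ}
    (hP : P ∈ stdSimplex ℝ A) {W : X → Matrix d d ℂ} (hW : ∀ x, (W x).PosSemidef)
    {Φ : Matrix d d ℂ → Matrix d d ℂ}
    (hΦ : ConcaveOn ℝ {B : Matrix d d ℂ | B.PosSemidef} Φ) :
    ∑ g, ∑ y, r g * (1 / (Fintype.card X : ℝ)) *
        (output W (pushforward P fun a => g a + y) *
          Φ (output W (pushforward P fun a => g a + y))).trace.re ≤
      ∑ a, P a * ((1 / (Fintype.card X : ℝ)) * ∑ x, (W x * Φ (condCoeff X (P a) • W x +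
        (1 - condCoeff X (P a)) • output W (unif X))).trace.re) := by
  simp_rw [output_pushforward]
  set N : ℝ := (Fintype.card X : ℝ) with hN
  let O : (A → X) → X → Matrix d d ℂ := fun g y => ∑ a, P a • W (g a + y)
  have hO : ∀ g y, (O g y).PosSemidef := fun g y =>
    posSemidef_sum _ fun a _ => (hW _).smul (hP.1 a)
  have e1 : ∀ g y, (O g y * Φ (O g y)).trace.re = ∑ a, P a * (W (g a + y) * Φ (O g y)).trace.re := by
    intro g y
    conv_lhs => rw [show O g y = ∑ a, P a • W (g a + y) from rfl, Finset.sum_mul, trace_sum,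
      Complex.re_sum]
    refine Finset.sum_congr rfl fun a _ => ?_
    rw [smul_mul_assoc, trace_smul, Complex.smul_re, smul_eq_mul]
  have e2 : ∑ g, ∑ y, r g * (1 / N) * (O g y * Φ (O g y)).trace.re =
      ∑ a, P a * ((1 / N) * ∑ x, ∑ g, r g * (W x * Φ (O g (x - g a))).trace.re) := by
    simp_rw [e1, Finset.mul_sum]
    calc _ = ∑ g, ∑ a, ∑ y, r g * (1 / N) * (P a * (W (g a + y) * Φ (O g y)).trace.re) :=
          Finset.sum_congr rfl fun g _ => Finset.sum_comm
      _ = ∑ g, ∑ a, ∑ x, r g * (1 / N) * (P a * (W x * Φ (O g (x - g a))).trace.re) := by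
          refine Finset.sum_congr rfl fun g _ => Finset.sum_congr rfl fun a _ => ?_
          -- The substitution y = x - g(a) frees the first factor from `g`, so Jensen can be applied
          -- over `g` alone.
          rw [← Equiv.sum_comp (Equiv.subRight (g a))]
          simp
      _ = ∑ a, ∑ x, ∑ g, r g * (1 / N) * (P a * (W x * Φ (O g (x - g a))).trace.re) := by
          rw [Finset.sum_comm]
          exact Finset.sum_congr rfl fun a _ => Finset.sum_comm
      _ = _ := by
          refine Finset.sum_congr rfl fun a _ => Finset.sum_congr rfl fun x _ =>
            Finset.sum_congr rfl fun g _ => ?_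
          ring
  change ∑ g, ∑ y, r g * (1 / N) * (O g y * Φ (O g y)).trace.re ≤ _
  rw [e2]
  refine Finset.sum_le_sum fun a _ => mul_le_mul_of_nonneg_left
    (mul_le_mul_of_nonneg_left (Finset.sum_le_sum fun x _ => ?_) (by positivity)) (hP.1 a)
  have hJ := hΦ.le_map_sum (t := Finset.univ) (w := r) (p := fun g => O g (x - g a))
    (fun g _ => h.nonneg g) h.sum_eq_one (fun g _ => hO _ _)
  have hmean : ∑ g, r g • O g (x - g a) = condCoeff X (P a) • W x +
      (1 - condCoeff X (P a)) • output W (unif X) := by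
    rw [show output W (unif X) = ∑ z, (1 / (Fintype.card X : ℝ)) • W z from rfl,
      ← h.condMean hP W a x]
    refine Finset.sum_congr rfl fun g _ => ?_
    by_cases hr : r g = 0
    · simp [hr]
    · congr 1
      refine Finset.sum_congr rfl fun b _ => ?_
      rw [h.map_sub g hr, show g b + (x - g a) = x + (g b - g a) by abel]
  rw [hmean] at hJ
  refine le_trans (le_of_eq ?_) (trace_mul_mono (hW x) hJ)
  rw [Finset.mul_sum, trace_sum, Complex.re_sum]
  refine Finset.sum_congr rfl fun g _ => ?_
  rw [mul_smul_comm, trace_smul, Complex.smul_re, smul_eq_mul]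

lemma IsRandomEmbedding.posSemidef_condMean (h : IsRandomEmbedding r) {P : A → ℝ}
    (hP : P ∈ stdSimplex ℝ A) {W : X → Matrix d d ℂ} (hW : ∀ x, (W x).PosSemidef) (a : A) (x : X) :
    (condCoeff X (P a) • W x + (1 - condCoeff X (P a)) • output W (unif X)).PosSemidef := by
  rw [show output W (unif X) = ∑ z, (1 / (Fintype.card X : ℝ)) • W z from rfl,
    ← h.condMean hP W a x]
  exact posSemidef_sum _ fun g _ => (posSemidef_sum _ fun b _ =>
    (hW _).smul (hP.1 b)).smul (h.nonneg g)

end Decoupling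

/-! ### The averaged bounds and the pointwise Jensen inequality. -/

section Average

variable {A X d : Type*} [AddCommGroup A] [AddCommGroup X] [Fintype A] [Fintype X]
  [DecidableEq X] [Fintype (A → X)] [Fintype d] [DecidableEq d] {r : (A → X) → ℝ}

lemma le_of_forall_le_add_mul {a b C : ℝ} (h : ∀ ε : ℝ, 0 < ε → a ≤ b + C * ε) : a ≤ b := by
  refine le_of_forall_pos_le_add fun δ hδ => ?_
  have hC : 0 < |C| + 1 := by positivity
  refine (h (δ / (|C| + 1)) (by positivity)).trans ?_
  have : C * (δ / (|C| + 1)) ≤ δ := by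
    rw [mul_div_assoc', div_le_iff₀ hC]
    nlinarith [le_abs_self C]
  linarith

lemma exp_neg_mul_renyi {P : A → ℝ} (hP : P ∈ stdSimplex ℝ A) {s : ℝ} (hs : 0 < s) :
    Real.exp (-s * renyi s P) = ∑ a, P a ^ (1 + s) := by
  have hpos : 0 < ∑ a, P a ^ (1 + s) := by
    have hne : ∃ a, P a ≠ 0 := by
      by_contra! hc
      have := hP.2
      simp [hc] at this
    obtain ⟨a, ha⟩ := hne
    exact Finset.sum_pos' (fun b _ => Real.rpow_nonneg (hP.1 b) _)
      ⟨a, Finset.mem_univ _, Real.rpow_pos_of_pos (lt_of_le_of_ne (hP.1 a) ha.symm) _⟩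
  rw [renyi, ← mul_assoc, show -s * (-1 / s) = 1 by field_simp, one_mul, Real.exp_log hpos]

/-- At 0 the right side is 1 because `Real.log 0 = 0`; the inequality is enough for upper bounds and
spares a proof that the traces are positive. -/
lemma le_exp_log {x : ℝ} (hx : 0 ≤ x) : x ≤ Real.exp (Real.log x) := by
  rcases hx.eq_or_lt with h | h
  · rw [← h]; positivity
  · rw [Real.exp_log h]

lemma pushforward_mem_stdSimplex {P : A → ℝ} (hP : P ∈ stdSimplex ℝ A) (g : A → X) :
    pushforward P g ∈ stdSimplex ℝ X := by
  refine ⟨fun x => Finset.sum_nonneg fun a _ => hP.1 a, ?_⟩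
  rw [← hP.2]
  exact Finset.sum_fiberwise Finset.univ g P

lemma le_one_of_mem_stdSimplex {P : A → ℝ} (hP : P ∈ stdSimplex ℝ A) (a : A) : P a ≤ 1 := by
  rw [← hP.2]
  exact Finset.single_le_sum (fun b _ => hP.1 b) (Finset.mem_univ a)

lemma unif_pos (x : X) : 0 < unif X x := by
  have := Fintype.card_pos_iff.2 ⟨x⟩
  rw [unif]; positivity

/-- The averaged power trace. -/
lemma IsRandomEmbedding.sum_mpow_le (h : IsRandomEmbedding r) {P : A → ℝ}
    (hP : P ∈ stdSimplex ℝ A) {W : X → Matrix d d ℂ} (hW : ∀ x, IsDensity (W x))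
    {s : ℝ} (hs0 : 0 < s) (hs1 : s ≤ 1) :
    ∑ g, ∑ y, r g * (1 / (Fintype.card X : ℝ)) *
        (output W (pushforward P fun a => g a + y) *
          mpow (sandwich (output W (pushforward P fun a => g a + y)) (output W (unif X))) s).trace.re
      ≤ 1 + Real.exp (-s * renyi s P) * Real.exp (psiLowChannel s W (unif X)) := by
  have : Nonempty X := ⟨0⟩
  set σ := output W (unif X) with hσ
  have dσ : IsDensity σ := isDensity_output hW unif_mem_stdSimplex
  have hsupp := suppLE_output hW unif_pos
  -- Sandwiching is linear and preserves positivity, so it preserves operator concavity.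
  have hc : ConcaveOn ℝ {B : Matrix d d ℂ | B.PosSemidef} (fun B => mpow (sandwich B σ) s) := by
    have := (concaveOn_mpow (d := d) hs0.le hs1).comp_linearMap (sandwichLM σ)
    refine this.subset (fun B hB => posSemidef_sandwich hB dσ.1) ?_
    exact fun A hA B hB s t hs ht _ => (PosSemidef.smul hA hs).add (PosSemidef.smul hB ht)
  refine (h.sum_trace_le hP (fun x => (hW x).1) hc).trans ?_
  rw [exp_neg_mul_renyi hP hs0, psiLowChannel_unif hW]
  have hT : 0 ≤ (1 / (Fintype.card X : ℝ)) * ∑ x, (W x * mpow (sandwich (W x) σ) s).trace.re :=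
    mul_nonneg (by positivity) (Finset.sum_nonneg fun x _ =>
      trace_mul_re_nonneg (hW x).1 (posSemidef_mpow (posSemidef_sandwich (hW x).1 dσ.1) _))
  have hN : (Fintype.card X : ℝ) ≠ 0 := by have := Fintype.card_pos (α := X); positivity
  calc _ ≤ ∑ a, P a * ((1 / (Fintype.card X : ℝ)) *
          ∑ x, (1 + P a ^ s * (W x * mpow (sandwich (W x) σ) s).trace.re)) := by
        refine Finset.sum_le_sum fun a _ => mul_le_mul_of_nonneg_left
          (mul_le_mul_of_nonneg_left (Finset.sum_le_sum fun x _ => ?_) (by positivity)) (hP.1 a)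
        exact trace_mul_mpow_sandwich_le (hW x) dσ (hsupp x) hs0 hs1 (hP.1 a)
          (le_one_of_mem_stdSimplex hP a) (condCoeff_le X (hP.1 a) (le_one_of_mem_stdSimplex hP a))
          (h.posSemidef_condMean hP (fun x => (hW x).1) a x)
    _ = 1 + (∑ a, P a ^ (1 + s)) *
          ((1 / (Fintype.card X : ℝ)) * ∑ x, (W x * mpow (sandwich (W x) σ) s).trace.re) := by
        have e : ∀ a, P a * ((1 / (Fintype.card X : ℝ)) *
            ∑ x, (1 + P a ^ s * (W x * mpow (sandwich (W x) σ) s).trace.re)) =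
            P a + P a ^ (1 + s) * ((1 / (Fintype.card X : ℝ)) *
              ∑ x, (W x * mpow (sandwich (W x) σ) s).trace.re) := by
          intro a
          rw [Finset.sum_add_distrib, ← Finset.mul_sum, Finset.sum_const, Finset.card_univ,
            nsmul_eq_mul, mul_one, Real.rpow_add' (hP.1 a) (by linarith), Real.rpow_one, mul_add,
            one_div_mul_cancel hN]
          ring
        simp_rw [e]
        rw [Finset.sum_add_distrib, hP.2, Finset.sum_mul]
    _ ≤ _ := by
        gcongr
        · exact Finset.sum_nonneg fun a _ => Real.rpow_nonneg (hP.1 a) _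
        · exact le_exp_log hT

/-- The averaged relative entropy. -/
lemma IsRandomEmbedding.sum_relEnt_le (h : IsRandomEmbedding r) {P : A → ℝ}
    (hP : P ∈ stdSimplex ℝ A) {W : X → Matrix d d ℂ} (hW : ∀ x, IsDensity (W x))
    {s : ℝ} (hs0 : 0 < s) (hs1 : s ≤ 1) :
    ∑ g, ∑ y, r g * (1 / (Fintype.card X : ℝ)) *
        (output W (pushforward P fun a => g a + y) *
          (mlog (output W (pushforward P fun a => g a + y)) - mlog (output W (unif X)))).trace.re
      ≤ (numEigenvalues (output W (unif X)) : ℝ) ^ s * Real.exp (-s * renyi s P) *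
        Real.exp (psiChannel s W (unif X)) / s := by
  have : Nonempty X := ⟨0⟩
  set σ := output W (unif X) with hσ
  set v : ℝ := (numEigenvalues σ : ℝ) with hv
  set N : ℝ := (Fintype.card X : ℝ) with hN
  have hN0 : N ≠ 0 := by have := Fintype.card_pos (α := X); positivity
  have hv0 : 0 ≤ v := Nat.cast_nonneg _
  have dσ : IsDensity σ := isDensity_output hW unif_mem_stdSimplex
  have hsupp := suppLE_output hW unif_pos
  set T : X → ℝ := fun x => (mpow (W x) (1 + s) * mpow σ (-s)).trace.re with hTdef
  have hT : 0 ≤ (1 / N) * ∑ x, T x :=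
    mul_nonneg (by positivity) (Finset.sum_nonneg fun x _ =>
      trace_mul_re_nonneg (posSemidef_mpow (hW x).1 _) (posSemidef_mpow dσ.1 _))
  have key : v ^ s * (∑ a, P a ^ (1 + s)) * ((1 / N) * ∑ x, T x) / s ≤
      v ^ s * Real.exp (-s * renyi s P) * Real.exp (psiChannel s W (unif X)) / s := by
    rw [exp_neg_mul_renyi hP hs0, psiChannel_unif hW]
    gcongr
    · exact mul_nonneg (by positivity) (Finset.sum_nonneg fun a _ => Real.rpow_nonneg (hP.1 a) _)
    · exact le_exp_log hT
  refine le_trans ?_ key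
  let O : (A → X) → X → Matrix d d ℂ := fun g y => output W (pushforward P fun a => g a + y)
  have hO : ∀ g y, (O g y).PosSemidef := fun g y =>
    posSemidef_output hW (pushforward_mem_stdSimplex hP _).1
  -- The constant collects two errors linear in ε: the one from negative coefficients and the one
  -- from regularising the relative entropy.
  refine le_of_forall_le_add_mul (C := ∑ a, P a * (|condCoeff X (P a)| * Fintype.card d) +
    ∑ g, ∑ y, r g * (1 / N) * (O g y * mpow σ (-1)).trace.re) fun ε hε => ?_
  have hreg : ∀ g y, (O g y * (mlog (O g y) - mlog σ)).trace.re ≤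
      (O g y * (mlog (O g y + ε • (1 : Matrix d d ℂ))
        - mlog (σ + ε • (1 : Matrix d d ℂ)))).trace.re + ε * (O g y * mpow σ (-1)).trace.re :=
    fun g y => trace_mlog_sub_le_regularised (hO g y) dσ.1
      (suppLE_output_of_forall hsupp _) hε
  have hc : ConcaveOn ℝ {B : Matrix d d ℂ | B.PosSemidef} (fun B =>
      mlog (B + ε • (1 : Matrix d d ℂ)) - mlog (σ + ε • (1 : Matrix d d ℂ))) :=
    (concaveOn_mlog_add hε).sub (convexOn_const _ (concaveOn_mlog_add hε).1)
  have h1 := h.sum_trace_le hP (fun x => (hW x).1) hc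
  have h2 : ∑ a, P a * ((1 / N) * ∑ x, (W x * (mlog (condCoeff X (P a) • W x +
        (1 - condCoeff X (P a)) • σ + ε • (1 : Matrix d d ℂ))
        - mlog (σ + ε • (1 : Matrix d d ℂ)))).trace.re) ≤
      v ^ s * (∑ a, P a ^ (1 + s)) * ((1 / N) * ∑ x, T x) / s
        + (∑ a, P a * (|condCoeff X (P a)| * Fintype.card d)) * ε := by
    calc _ ≤ ∑ a, P a * ((1 / N) * ∑ x, ((v * P a) ^ s / s * T x
            + |condCoeff X (P a)| * Fintype.card d * ε)) := by
          refine Finset.sum_le_sum fun a _ => mul_le_mul_of_nonneg_left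
            (mul_le_mul_of_nonneg_left (Finset.sum_le_sum fun x _ => ?_) (by positivity)) (hP.1 a)
          exact trace_mul_mlog_sub_le (hW x) dσ (hsupp x) hs0 hs1 hε (hP.1 a)
            (le_one_of_mem_stdSimplex hP a)
            (condCoeff_le X (hP.1 a) (le_one_of_mem_stdSimplex hP a))
            (h.posSemidef_condMean hP (fun x => (hW x).1) a x)
      _ = _ := by
          rw [Finset.mul_sum, Finset.sum_mul, Finset.sum_div, Finset.sum_mul,
            ← Finset.sum_add_distrib]
          refine Finset.sum_congr rfl fun a _ => ?_
          rw [Finset.sum_add_distrib, ← Finset.mul_sum, Finset.sum_const, Finset.card_univ,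
            nsmul_eq_mul, Real.rpow_add' (hP.1 a) (by linarith), Real.rpow_one,
            Real.mul_rpow hv0 (hP.1 a), ← hN]
          field_simp
  have h3 : ∑ g, ∑ y, r g * (1 / N) * (O g y * (mlog (O g y) - mlog σ)).trace.re ≤
      ∑ g, ∑ y, r g * (1 / N) * (O g y * (mlog (O g y + ε • (1 : Matrix d d ℂ))
        - mlog (σ + ε • (1 : Matrix d d ℂ)))).trace.re
      + (∑ g, ∑ y, r g * (1 / N) * (O g y * mpow σ (-1)).trace.re) * ε := by
    simp_rw [Finset.sum_mul, ← Finset.sum_add_distrib]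
    refine Finset.sum_le_sum fun g _ => Finset.sum_le_sum fun y _ => ?_
    have := mul_le_mul_of_nonneg_left (hreg g y)
      (mul_nonneg (h.nonneg g) (show 0 ≤ 1 / N by positivity))
    linarith
  have h4 := h3.trans (add_le_add_left (h1.trans h2) _)
  rw [add_mul, ← add_assoc]
  exact h4

lemma relEnt_eq_of_suppLE {ρ σ : Matrix d d ℂ} (h : SuppLE ρ σ) :
    relEnt ρ σ = ((ρ * (mlog ρ - mlog σ)).trace.re : ℝ) := by
  rw [relEnt, if_pos h]

/-- The case of exponent one is at least 1, so some eigenvector has positive weight and positive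
eigenvalue, and its term is positive for every exponent. -/
lemma trace_mul_mpow_sandwich_pos {ρ σ : Matrix d d ℂ} (hρ : IsDensity ρ) (hσ : IsDensity σ)
    (hs : SuppLE ρ σ) (s : ℝ) : 0 < (ρ * mpow (sandwich ρ σ) s).trace.re := by
  have hρ' := posSemidef_sandwich hρ.1 hσ.1
  obtain ⟨V, t, hV⟩ := exists_hasDiag hρ'.1
  have h1 := one_le_trace_mul_sandwich hρ hσ hs
  rw [hV.trace_mul] at h1
  rw [mpow, hV.trace_mul_cfc]
  have hw := weight_nonneg hρ.1 V
  have ht := hV.nonneg hρ'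
  obtain ⟨i, hi⟩ : ∃ i, weight ρ V i * t i ≠ 0 := by
    by_contra! hc
    simp [hc] at h1
    linarith
  refine Finset.sum_pos' (fun j _ => mul_nonneg (hw j) (Real.rpow_nonneg (ht j) _))
    ⟨i, Finset.mem_univ _, ?_⟩
  exact mul_pos (lt_of_le_of_ne (hw i) (left_ne_zero_of_mul hi).symm)
    (Real.rpow_pos_of_pos (lt_of_le_of_ne (ht i) (right_ne_zero_of_mul hi).symm) _)

lemma exp_psiLow {ρ σ : Matrix d d ℂ} (hρ : IsDensity ρ) (hσ : IsDensity σ)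
    (hs : SuppLE ρ σ) (s : ℝ) :
    Real.exp (psiLow s ρ σ) = (ρ * mpow (sandwich ρ σ) s).trace.re :=
  Real.exp_log (trace_mul_mpow_sandwich_pos hρ hσ hs s)

/-- Jensen's inequality between the second relative entropy and its Rényi version. -/
lemma exp_mul_relEntLow_le {ρ σ : Matrix d d ℂ} (hρ : IsDensity ρ) (hσ : IsDensity σ)
    (hs : SuppLE ρ σ) {s : ℝ} (hs0 : 0 < s) :
    EReal.exp ((s : EReal) * relEntLow ρ σ) ≤ ENNReal.ofReal (Real.exp (psiLow s ρ σ)) := by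
  rw [relEntLow, if_pos hs]
  split_ifs with hk
  · rw [← EReal.coe_mul, EReal.exp_coe, exp_psiLow hρ hσ hs]
    refine ENNReal.ofReal_le_ofReal ?_
    have hρ' := posSemidef_sandwich hρ.1 hσ.1
    obtain ⟨V, t, hV⟩ := exists_hasDiag hρ'.1
    have hw := weight_nonneg hρ.1 V
    have ht := hV.nonneg hρ'
    have hw1 : ∑ i, weight ρ V i = 1 := by rw [sum_weight hV.unitary, hρ.2]; simp
    have hk' := congrArg Complex.re hk
    -- No weight lies on the kernel, so the default `Real.log 0 = 0` is never seen.
    rw [kerProj, hV.trace_mul_cfc, Complex.zero_re, Finset.sum_eq_zero_iff_of_nonneg fun i _ =>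
      mul_nonneg (hw i) (by split_ifs <;> simp)] at hk'
    have hz : ∀ i, t i = 0 → weight ρ V i = 0 := fun i hi => by
      simpa [hi] using hk' i (Finset.mem_univ _)
    rw [mlog, mpow, hV.trace_mul_cfc, hV.trace_mul_cfc, Finset.mul_sum]
    have hJ := convexOn_exp.map_sum_le (t := Finset.univ) (w := weight ρ V)
      (p := fun i => s * Real.log (t i)) (fun i _ => hw i) hw1 (fun _ _ => Set.mem_univ _)
    simp only [smul_eq_mul] at hJ
    calc _ = Real.exp (∑ i, weight ρ V i * (s * Real.log (t i))) := by
          congr 1; exact Finset.sum_congr rfl fun i _ => by ring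
      _ ≤ _ := hJ
      _ = _ := by
          refine Finset.sum_congr rfl fun i _ => ?_
          rcases (ht i).eq_or_lt with h | h
          · rw [hz i h.symm]; simp
          · rw [Real.rpow_def_of_pos h, mul_comm s]
  · rw [EReal.coe_mul_bot_of_pos hs0]
    simp

end Average

/-! ### From random variables to finite sums over their laws. -/

section Law

open MeasureTheory

variable {A X Ω : Type*} [Fintype A] [Fintype X] [DecidableEq X] [MeasurableSpace X]
  [DiscreteMeasurableSpace X] [Fintype (A → X)] [MeasurableSpace Ω]

/-- The expectation of a function of a random map and an independent uniform shift. -/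
lemma lintegral_map_shift (μ : Measure Ω) [IsProbabilityMeasure μ]
    {F : Ω → A → X} (hF : Measurable F) {Y : Ω → X} (hY : Measurable Y)
    (hYu : ∀ x : X, μ.real {ω | Y ω = x} = 1 / (Fintype.card X : ℝ))
    (hind : ProbabilityTheory.IndepFun F Y μ) {φ : (A → X) → X → ℝ} (hφ : ∀ g y, 0 ≤ φ g y) :
    ∫⁻ ω, ENNReal.ofReal (φ (F ω) (Y ω)) ∂μ =
      ENNReal.ofReal (∑ g, ∑ y, μ.real (F ⁻¹' {g}) * (1 / (Fintype.card X : ℝ)) * φ g y) := by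
  have hZ : Measurable fun ω => (F ω, Y ω) := hF.prodMk hY
  have hm : Measurable fun z : (A → X) × X => ENNReal.ofReal (φ z.1 z.2) := measurable_of_finite _
  rw [show ∫⁻ ω, ENNReal.ofReal (φ (F ω) (Y ω)) ∂μ
      = ∫⁻ z, ENNReal.ofReal (φ z.1 z.2) ∂(μ.map fun ω => (F ω, Y ω)) from
    (lintegral_map hm hZ).symm, lintegral_fintype, Fintype.sum_prod_type,
    ENNReal.ofReal_sum_of_nonneg fun g _ => Finset.sum_nonneg fun y _ =>
      mul_nonneg (by positivity) (hφ g y)]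
  refine Finset.sum_congr rfl fun g _ => ?_
  rw [ENNReal.ofReal_sum_of_nonneg fun y _ => mul_nonneg (by positivity) (hφ g y)]
  refine Finset.sum_congr rfl fun y _ => ?_
  rw [Measure.map_apply hZ (measurableSet_singleton _)]
  have e : (fun ω => (F ω, Y ω)) ⁻¹' {(g, y)} = F ⁻¹' {g} ∩ Y ⁻¹' {y} := by
    ext ω; simp
  have e2 : μ (Y ⁻¹' {y}) = ENNReal.ofReal (1 / (Fintype.card X : ℝ)) := by
    rw [← hYu y, ofReal_measureReal]; rfl
  rw [e, hind.measure_inter_preimage_eq_mul _ _ (measurableSet_singleton _)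
    (measurableSet_singleton _), e2, ENNReal.ofReal_mul (by positivity),
    ENNReal.ofReal_mul (by positivity), ofReal_measureReal, mul_comm]

end Law

section Law

open MeasureTheory

variable {R A X Ω : Type*} [Ring R] [AddCommGroup A] [Module R A] [Fintype A]
  [AddCommGroup X] [Module R X] [Fintype X] [DecidableEq X]
  [MeasurableSpace X] [DiscreteMeasurableSpace X] [Fintype (A → X)] [MeasurableSpace Ω]

/-- A map of nonzero mass has a nonempty preimage, so it equals some `f ω` and inherits injectivity
and additivity. -/
lemma isRandomEmbedding_law (μ : Measure Ω) [IsProbabilityMeasure μ]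
    (f : Ω → (A →ₗ[R] X)) (hfm : ∀ a, Measurable (fun ω => f ω a))
    (hfinj : ∀ ω, Function.Injective (f ω))
    (hf : ∀ x : X, x ≠ 0 → ∀ a : A, a ≠ 0 →
      μ.real {ω | f ω a = x} ≤ 1 / ((Fintype.card X : ℝ) - 1)) :
    IsRandomEmbedding fun g : A → X => μ.real ((fun ω => (fun a => f ω a : A → X)) ⁻¹' {g}) := by
  have hF : Measurable fun ω => (fun a => f ω a : A → X) := measurable_pi_iff.2 hfm
  have hne : ∀ g : A → X, μ.real ((fun ω => (fun a => f ω a : A → X)) ⁻¹' {g}) ≠ 0 →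
      ∃ ω, (fun a => f ω a) = g := by
    intro g hg
    by_contra! hc
    refine hg ?_
    have he : (fun ω => (fun a => f ω a : A → X)) ⁻¹' {g} = ∅ :=
      Set.eq_empty_of_forall_notMem fun ω hω => hc ω hω
    rw [he, measureReal_empty]
  refine ⟨fun g => measureReal_nonneg, ?_, ?_, ?_, ?_⟩
  · rw [sum_measureReal_preimage_singleton _ fun g _ => hF (measurableSet_singleton g)]
    simp
  · intro g hg
    obtain ⟨ω, rfl⟩ := hne g hg
    exact hfinj ω
  · intro g hg a b
    obtain ⟨ω, rfl⟩ := hne g hg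
    exact map_sub (f ω) a b
  · intro x hx a ha
    rw [sum_measureReal_preimage_singleton _ fun g _ => hF (measurableSet_singleton g)]
    refine le_trans (le_of_eq ?_) (hf x hx a ha)
    congr 1
    ext ω
    simp

end Law

end CQ

/-! ### The main theorem. -/

theorem mainTheorem7
    {R A X d Ω : Type*} [Ring R]
    [AddCommGroup A] [Module R A] [Fintype A]
    [AddCommGroup X] [Module R X] [Fintype X] [DecidableEq X]
    [MeasurableSpace X] [DiscreteMeasurableSpace X]
    [Fintype d] [DecidableEq d]
    [MeasurableSpace Ω] (μ : MeasureTheory.Measure Ω) [MeasureTheory.IsProbabilityMeasure μ]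
    -- the classical-quantum channel
    (W : X → Matrix d d ℂ) (hW : ∀ x, CQ.IsDensity (W x))
    -- the distribution on the module `A`
    (P : A → ℝ) (hP : P ∈ stdSimplex ℝ A)
    -- the random injective homomorphism
    (f : Ω → (A →ₗ[R] X)) (hfm : ∀ a, Measurable (fun ω => f ω a))
    (hfinj : ∀ ω, Function.Injective (f ω))
    (hf : ∀ x : X, x ≠ 0 → ∀ a : A, a ≠ 0 →
      μ.real {ω | f ω a = x} ≤ 1 / ((Fintype.card X : ℝ) - 1))
    -- the uniform shift, independent of the random homomorphism
    (Y : Ω → X) (hYm : Measurable Y)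
    (hY : ∀ x : X, μ.real {ω | Y ω = x} = 1 / (Fintype.card X : ℝ))
    (hind : ProbabilityTheory.IndepFun (fun ω => (fun a => f ω a : A → X)) Y μ)
    (s : ℝ) (hs0 : 0 < s) (hs1 : s ≤ 1) :
    let Wmix : Matrix d d ℂ := CQ.output W (CQ.unif X)
    let Wout : Ω → Matrix d d ℂ := fun ω =>
      CQ.output W (CQ.pushforward P (fun a => f ω a + Y ω))
    let v : ℝ := (CQ.numEigenvalues Wmix : ℝ)
    (∫⁻ ω, (CQ.relEnt (Wout ω) Wmix).toENNReal ∂μ ≤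
      ENNReal.ofReal (v ^ s * Real.exp (-s * CQ.renyi s P) *
        Real.exp (CQ.psiChannel s W (CQ.unif X)) / s)) ∧
    (∫⁻ ω, EReal.exp ((s : EReal) * CQ.relEntLow (Wout ω) Wmix) ∂μ ≤
      ∫⁻ ω, ENNReal.ofReal (Real.exp (CQ.psiLow s (Wout ω) Wmix)) ∂μ) ∧
    (∫⁻ ω, ENNReal.ofReal (Real.exp (CQ.psiLow s (Wout ω) Wmix)) ∂μ ≤
      ENNReal.ofReal (1 + Real.exp (-s * CQ.renyi s P) *
        Real.exp (CQ.psiLowChannel s W (CQ.unif X)))) := by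
  classical
  intro Wmix Wout v
  let F : Ω → A → X := fun ω a => f ω a
  have hF : Measurable F := measurable_pi_iff.2 hfm
  have hr := CQ.isRandomEmbedding_law μ f hfm hfinj hf
  have hX : Nonempty X := ⟨0⟩
  have dmix : CQ.IsDensity Wmix := CQ.isDensity_output hW CQ.unif_mem_stdSimplex
  have hsupp : ∀ p, CQ.SuppLE (CQ.output W p) Wmix :=
    CQ.suppLE_output_of_forall (CQ.suppLE_output hW CQ.unif_pos)
  let O : (A → X) → X → Matrix d d ℂ := fun g y =>
    CQ.output W (CQ.pushforward P fun a => g a + y)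
  have dO : ∀ g y, CQ.IsDensity (O g y) := fun g y =>
    CQ.isDensity_output hW (CQ.pushforward_mem_stdSimplex hP _)
  refine ⟨?_, MeasureTheory.lintegral_mono fun ω =>
    CQ.exp_mul_relEntLow_le (dO (F ω) (Y ω)) dmix (hsupp _) hs0, ?_⟩
  · have e : ∀ ω, (CQ.relEnt (Wout ω) Wmix).toENNReal = ENNReal.ofReal
        ((O (F ω) (Y ω) * (CQ.mlog (O (F ω) (Y ω)) - CQ.mlog Wmix)).trace.re) := by
      intro ω
      rw [CQ.relEnt_eq_of_suppLE (hsupp _), EReal.toENNReal_of_ne_top (EReal.coe_ne_top _),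
        EReal.toReal_coe]
    -- Klein's inequality for unit traces; it ensures that `ENNReal.ofReal` truncates nothing.
    have hnn : ∀ g y, 0 ≤ (O g y * (CQ.mlog (O g y) - CQ.mlog Wmix)).trace.re := by
      intro g y
      have := CQ.klein (dO g y).1 dmix.1 (hsupp _)
      rwa [Matrix.trace_sub, (dO g y).2, dmix.2, sub_self, Complex.zero_re] at this
    rw [MeasureTheory.lintegral_congr e, CQ.lintegral_map_shift μ hF hYm hY hind
      (φ := fun g y => (O g y * (CQ.mlog (O g y) - CQ.mlog Wmix)).trace.re) hnn]
    exact ENNReal.ofReal_le_ofReal (hr.sum_relEnt_le hP hW hs0 hs1)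
  · have e : ∀ ω, ENNReal.ofReal (Real.exp (CQ.psiLow s (Wout ω) Wmix)) = ENNReal.ofReal
        ((O (F ω) (Y ω) * CQ.mpow (CQ.sandwich (O (F ω) (Y ω)) Wmix) s).trace.re) := fun ω => by
      rw [← CQ.exp_psiLow (dO _ _) dmix (hsupp _)]
    rw [MeasureTheory.lintegral_congr e, CQ.lintegral_map_shift μ hF hYm hY hind
      (φ := fun g y => (O g y * CQ.mpow (CQ.sandwich (O g y) Wmix) s).trace.re)
      fun g y => (CQ.trace_mul_mpow_sandwich_pos (dO g y) dmix (hsupp _) s).le]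
    exact ENNReal.ofReal_le_ofReal (hr.sum_mpow_le hP hW hs0 hs1)
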